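/- Let $X\subset\mathbb R^{n_x}$, $Y\subset\mathbb R^{n_y}$ be open, $\Xi=\mathbb R^{n_\xi}\setminus\{0\}$, $\langle\xi\rangle=(1+\|\xi\|^2)^{1/2}$, and let $\alpha>0$, $d\in\mathbb R$, $0\le\delta<1$, $0<\varrho\le1$. For $Z$ open put $K_{Z,m}=\{z\in Z:\|z\|\le m,\ \mathrm{dist}(z,Z^c)\ge 1/m\}$ (with $1/0=\infty$ and distance $\infty$ to the empty set). Let $\mathcal M_\alpha$ be the set of smooth $\Phi:X\times Y\times\Xi\to\mathbb R$, positively homogeneous of degree $1$ in $\xi$, with $\|\xi\|^{-2}\|\nabla_x\Phi\|^2+\|\nabla_\xi\Phi\|^2\ge\alpha$ and $\|\xi\|^{-2}\|\nabla_y\Phi\|^2+\|\nabla_\xi\Phi\|^2\ge\alpha$ everywhere, with seminorms $$p_m(\Phi)=\sup\{|\partial_x^{j}\partial_y^{k}\partial_\xi^{l}\Phi(x,y,\xi)|: x\in K_{X,m},\,y\in K_{Y,m},\,\|\xi\|=1,\,|j|+|k|+|l|\le m\}.$$ Let $\mathcal S^d_{\varrho,\delta}$ be the set of restrictions to $X\times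 Y\times\Xi$ of Hörmander symbols $a\in S^d_{\varrho,\delta}(X\times Y\times\mathbb R^{n_\xi})$ (smooth complex-valued functions such that, for all multi-indices and all compact $K\subset X\times Y$, $|\partial_x^j\partial_y^k\partial_\xi^l a|\le C\langle\xi\rangle^{d-\varrho|l|+\delta(|j|+|k|)}$ for $(x,y)\in K$, $\xi\in\mathbb R^{n_\xi}$), with seminorms $$q_m(a)=\sup\{\langle\xi\rangle^{-d+\varrho|l|-\delta(|j|+|k|)}|\partial_x^j\partial_y^k\partial_\xi^l a(x,y,\xi)|: x\in K_{X,m},\,y\in K_{Y,m},\,\xi\in\Xi,\,|j|+|k|+|l|\le m\}.$$ Let $\mathcal F=\mathcal M_\alpha\times\mathcal S^d_{\varrho,\delta}$ with the product topology, and for functions $v$ on $X$ let $\pi_{X,m}(v)=\sup\{|\partial_x^jv(x)|:x\in K_{X,m},|j|\le m\}$. Fix $\chi\in\mathcal D(\mathbb R^{n_\xi})$ with $\chi=1$ for $\|\xi\|<1$ and $\chi=0$ for $\|\xi\|>2$. For $\Phi\in\mathcal M_\alpha$ put $r=\|\xi\|^2\|\nabla_\xi\Phi\|^2+\|\nabla_y\Phi\|^2$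 and $$L_\Phi f=-\sum_l\partial_{\xi_l}\Big(\tfrac{-i}{r}(1-\chi)\|\xi\|^2(\partial_{\xi_l}\Phi) f\Big)-\sum_k\partial_{y_k}\Big(\tfrac{-i}{r}(1-\chi)(\partial_{y_k}\Phi) f\Big)+\chi f .$$ Fix $\psi\in\mathcal D(Y)$ and $\widetilde m\in\mathbb N$, and let $\kappa\in\mathbb N$ be so large that $d+\widetilde m-\kappa\min(1-\delta,\varrho)\le-(n_\xi+1)$. For $(\Phi,a)\in\mathcal F$ set $$A_{\Phi,a}[\psi](x)=(2\pi)^{-n_\xi}\int_\Xi\int_Y e^{i\Phi(x,y,\xi)}L_\Phi^\kappa\big(a\psi\big)(x,y,\xi)\,dy\,d\xi .$$ (a) Let $m\ge\kappa+\widetilde m+1$ with $\operatorname{supp}\psi\subset K_{Y,m}$. Then there is a function $C:[0,\infty]^2\to[0,\infty)$ (which may depend on $m$, $\psi$ and the other fixed data, but not on $\Phi$, $a$) such that for all $(\Phi,a)\in\mathcal F$ (in particular for every member of a convergent sequence $(\Phi_n,a_n)$), all $|j|\le\widetilde m$ and all $\xi\in\Xi$ $$\sup_{x\in K_{X,\widetilde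 m},\,y\in Y}\Big|\partial_x^j\Big(e^{i\Phi(x,y,\xi)}L_\Phi^\kappa(a\psi)(x,y,\xi)\Big)\Big|\le C\big(p_m(\Phi),q_m(a)\big)\,\langle\xi\rangle^{-(n_\xi+1)} .$$ (b) For every $(\Phi,a)\in\mathcal F$ the integral defining $A_{\Phi,a}[\psi](x)$ converges absolutely for every $x\in X$, and $A_{\Phi,a}[\psi]\in\mathcal C^{\widetilde m}(X)$. If $(\Phi_n,a_n)\in\mathcal F$ converges to $(\Phi,a)\in\mathcal F$, i.e. $p_k(\Phi_n-\Phi)\to0$ and $q_k(a_n-a)\to0$ for all $k\in\mathbb N$, then $$\lim_{n\to\infty}\pi_{X,\widetilde m}\big(A_{\Phi_n,a_n}[\psi]-A_{\Phi,a}[\psi]\big)=0 .$$ -/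

import Mathlib

open Filter Topology MeasureTheory Set TopologicalSpace
open scoped ENNReal NNReal ContDiff Distributions

noncomputable section

namespace FourierOp

/-- `ℝⁿ` with its Euclidean norm. -/
abbrev Euc (n : ℕ) : Type := EuclideanSpace ℝ (Fin n)

/-- The space of triples `(x, y, ξ)`. A function on an open subset of it is represented by a
function on the whole space, of which only the values on that open subset matter. -/
abbrev Triple (nx ny nξ : ℕ) : Type := Euc nx × Euc ny × Euc nξ

section Derivatives

variable {E F : Type*} [NormedAddCommGroup E] [NormedSpace ℝ E]
  [NormedAddCommGroup F] [NormedSpace ℝ F]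

/-- The partial derivative of `f` in the direction `v`. -/
def partialD (v : E) (f : E → F) : E → F := fun z => fderiv ℝ f z v

/-- The derivative `∂_{e 0}^{j 0} ⋯ ∂_{e (n-1)}^{j (n-1)} f` for a multi-index `j` and
directions `e`. -/
def multiD {n : ℕ} (e : Fin n → E) (j : Fin n → ℕ) (f : E → F) : E → F :=
  (List.finRange n).foldr (fun i g => (partialD (e i))^[j i] g) f

/-- The length `|j|` of a multi-index. -/
def len {n : ℕ} (j : Fin n → ℕ) : ℕ := ∑ i, j i

end Derivatives

variable {nx ny nξ : ℕ}

/-- The `i`-th standard basis vector of `ℝⁿ`. -/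
def stdDir {n : ℕ} (i : Fin n) : Euc n := EuclideanSpace.single i 1

/-- The coordinate direction of `x_i`. -/
def dirX (i : Fin nx) : Triple nx ny nξ := (stdDir i, 0, 0)

/-- The coordinate direction of `y_k`. -/
def dirY (k : Fin ny) : Triple nx ny nξ := (0, stdDir k, 0)

/-- The coordinate direction of `ξ_l`. -/
def dirXi (l : Fin nξ) : Triple nx ny nξ := (0, 0, stdDir l)

/-- `∂_x^j ∂_y^k ∂_ξ^l f`. -/
def mixedD {F : Type*} [NormedAddCommGroup F] [NormedSpace ℝ F]
    (j : Fin nx → ℕ) (k : Fin ny → ℕ) (l : Fin nξ → ℕ) (f : Triple nx ny nξ → F) :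
    Triple nx ny nξ → F :=
  multiD dirX j (multiD dirY k (multiD dirXi l f))

/-- `⟨ξ⟩ = (1 + ‖ξ‖²)^{1/2}`. -/
def bracket {n : ℕ} (ξ : Euc n) : ℝ := Real.sqrt (1 + ‖ξ‖ ^ 2)

/-- `Ξ = ℝⁿ ∖ {0}`. -/
def punctured (n : ℕ) : Set (Euc n) := {ξ | ξ ≠ 0}

/-- `X × Y × Ξ`. -/
def domain (X : Opens (Euc nx)) (Y : Opens (Euc ny)) (nξ : ℕ) : Set (Triple nx ny nξ) :=
  (X : Set (Euc nx)) ×ˢ (Y : Set (Euc ny)) ×ˢ punctured nξ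

/-- The compact exhaustion `K_{Z,m} = {x ∈ Z : ‖x‖ ≤ m, dist(x, ℝⁿ ∖ Z) ≥ 1/m}`; the distance is
extended-valued, so that the distance to the empty set is `∞`, and `1/0 = ∞`. -/
def exhaustion {n : ℕ} (Z : Opens (Euc n)) (m : ℕ) : Set (Euc n) :=
  {x | x ∈ Z ∧ ‖x‖ ≤ m ∧ (m : ℝ≥0∞)⁻¹ ≤ Metric.infEDist x (Z : Set (Euc n))ᶜ}

/-- `M_hg`: smooth real functions on `X × Y × Ξ`, positively homogeneous of degree one in `ξ`. -/
def Mhg (X : Opens (Euc nx)) (Y : Opens (Euc ny)) (nξ : ℕ) : Set (Triple nx ny nξ → ℝ) :=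
  {Φ | ContDiffOn ℝ ∞ Φ (domain X Y nξ) ∧
    ∀ x ∈ X, ∀ y ∈ Y, ∀ ξ ∈ punctured nξ, ∀ t : ℝ, 0 < t → Φ (x, y, t • ξ) = t * Φ (x, y, ξ)}

/-- `M_α`: the functions in `M_hg` whose gradients in `(x, ξ)` and in `(y, ξ)`, with weight
`‖ξ‖⁻¹` on the `x`- and `y`-components, have squared norm at least `α` on `X × Y × Ξ`. -/
def Malpha (α : ℝ) (X : Opens (Euc nx)) (Y : Opens (Euc ny)) (nξ : ℕ) :
    Set (Triple nx ny nξ → ℝ) :=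
  {Φ | Φ ∈ Mhg X Y nξ ∧
    ∀ x ∈ X, ∀ y ∈ Y, ∀ ξ ∈ punctured nξ,
      α ≤ ∑ i, (‖ξ‖⁻¹ * partialD (dirX i) Φ (x, y, ξ)) ^ 2
            + ∑ l, (partialD (dirXi l) Φ (x, y, ξ)) ^ 2 ∧
      α ≤ ∑ k, (‖ξ‖⁻¹ * partialD (dirY k) Φ (x, y, ξ)) ^ 2
            + ∑ l, (partialD (dirXi l) Φ (x, y, ξ)) ^ 2}

/-- The Hörmander symbol class `S^d_{ρ,δ}(X × Y × ℝ^{nξ})`. -/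
def symbolClass (d ρ δ : ℝ) (X : Opens (Euc nx)) (Y : Opens (Euc ny)) (nξ : ℕ) :
    Set (Triple nx ny nξ → ℂ) :=
  {a | ContDiffOn ℝ ∞ a ((X : Set (Euc nx)) ×ˢ (Y : Set (Euc ny)) ×ˢ (univ : Set (Euc nξ))) ∧
    ∀ (j : Fin nx → ℕ) (k : Fin ny → ℕ) (l : Fin nξ → ℕ) (K : Set (Euc nx × Euc ny)),
      IsCompact K → K ⊆ (X : Set (Euc nx)) ×ˢ (Y : Set (Euc ny)) →
      ∃ C : ℝ, ∀ x y, (x, y) ∈ K → ∀ ξ : Euc nξ,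
        ‖mixedD j k l a (x, y, ξ)‖
          ≤ C * bracket ξ ^ (d - ρ * (len l : ℝ) + δ * ((len j : ℝ) + (len k : ℝ)))}

/-- The space of amplitudes: restrictions to `X × Y × Ξ` of elements of the symbol class. -/
def amplitudes (d ρ δ : ℝ) (X : Opens (Euc nx)) (Y : Opens (Euc ny)) (nξ : ℕ) :
    Set (Triple nx ny nξ → ℂ) :=
  {a | ∃ b ∈ symbolClass d ρ δ X Y nξ, EqOn a b (domain X Y nξ)}

/-- The seminorm `p_m` on `M_hg`. -/
def phaseSeminorm (X : Opens (Euc nx)) (Y : Opens (Euc ny)) (m : ℕ)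
    (Φ : Triple nx ny nξ → ℝ) : ℝ≥0∞ :=
  ⨆ (x ∈ exhaustion X m) (y ∈ exhaustion Y m) (ξ : Euc nξ) (_ : ‖ξ‖ = 1)
    (j : Fin nx → ℕ) (k : Fin ny → ℕ) (l : Fin nξ → ℕ) (_ : len j + len k + len l ≤ m),
    ‖mixedD j k l Φ (x, y, ξ)‖ₑ

/-- The seminorm `q_m` on the space of amplitudes. -/
def ampSeminorm (d ρ δ : ℝ) (X : Opens (Euc nx)) (Y : Opens (Euc ny)) (m : ℕ)
    (a : Triple nx ny nξ → ℂ) : ℝ≥0∞ :=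
  ⨆ (x ∈ exhaustion X m) (y ∈ exhaustion Y m) (ξ ∈ punctured nξ)
    (j : Fin nx → ℕ) (k : Fin ny → ℕ) (l : Fin nξ → ℕ) (_ : len j + len k + len l ≤ m),
    ENNReal.ofReal (bracket ξ ^ (-d + ρ * (len l : ℝ) - δ * ((len j : ℝ) + (len k : ℝ))))
      * ‖mixedD j k l a (x, y, ξ)‖ₑ

/-- The space `F^d_{α,ρ,δ}(X, Y, Ξ) = M_α × S^d_{ρ,δ}` of pairs (phase function, amplitude). -/
def fioSpace (α d ρ δ : ℝ) (X : Opens (Euc nx)) (Y : Opens (Euc ny)) (nξ : ℕ) :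
    Set ((Triple nx ny nξ → ℝ) × (Triple nx ny nξ → ℂ)) :=
  Malpha α X Y nξ ×ˢ amplitudes d ρ δ X Y nξ

/-- Convergence `(Φ_n, a_n) → (Φ, a)` in the product topology given by all `p_m` and `q_m`. -/
def Converges (d ρ δ : ℝ) (X : Opens (Euc nx)) (Y : Opens (Euc ny))
    (P : ℕ → (Triple nx ny nξ → ℝ) × (Triple nx ny nξ → ℂ))
    (P' : (Triple nx ny nξ → ℝ) × (Triple nx ny nξ → ℂ)) : Prop :=
  ∀ m : ℕ,
    Tendsto (fun n => phaseSeminorm X Y m ((P n).1 - P'.1)) atTop (𝓝 0) ∧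
    Tendsto (fun n => ampSeminorm d ρ δ X Y m ((P n).2 - P'.2)) atTop (𝓝 0)

/-- The seminorm `π_{X,m}` on functions on `X`. -/
def funSeminorm (X : Opens (Euc nx)) (m : ℕ) (v : Euc nx → ℂ) : ℝ≥0∞ :=
  ⨆ (x ∈ exhaustion X m) (j : Fin nx → ℕ) (_ : len j ≤ m), ‖multiD stdDir j v x‖ₑ

/-- A cut-off function: equal to `1` for `‖ξ‖ < 1` and to `0` for `‖ξ‖ > 2`. -/
def IsCutoff (χ : 𝓓((⊤ : Opens (Euc nξ)), ℂ)) : Prop :=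
  (∀ ξ, ‖ξ‖ < 1 → χ ξ = 1) ∧ (∀ ξ, 2 < ‖ξ‖ → χ ξ = 0)

/-- `r = ∑_l ‖ξ‖² |∂_{ξ_l} Φ|² + ∑_k |∂_{y_k} Φ|²`. -/
def regR (Φ : Triple nx ny nξ → ℝ) (z : Triple nx ny nξ) : ℝ :=
  ∑ l, ‖z.2.2‖ ^ 2 * |partialD (dirXi l) Φ z| ^ 2 + ∑ k, |partialD (dirY k) Φ z| ^ 2

/-- The coefficient `(-i/r) (1-χ) ‖ξ‖² ∂_{ξ_l} Φ`. -/
def coeffAlpha (χ : Euc nξ → ℂ) (Φ : Triple nx ny nξ → ℝ) (l : Fin nξ)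
    (z : Triple nx ny nξ) : ℂ :=
  (-Complex.I / (regR Φ z : ℂ)) * (1 - χ z.2.2) * ((‖z.2.2‖ ^ 2 * partialD (dirXi l) Φ z : ℝ) : ℂ)

/-- The coefficient `(-i/r) (1-χ) ∂_{y_k} Φ`. -/
def coeffBeta (χ : Euc nξ → ℂ) (Φ : Triple nx ny nξ → ℝ) (k : Fin ny)
    (z : Triple nx ny nξ) : ℂ :=
  (-Complex.I / (regR Φ z : ℂ)) * (1 - χ z.2.2) * ((partialD (dirY k) Φ z : ℝ) : ℂ)

/-- The regularizing operator
`L f = -∑_l ∂_{ξ_l} (α_l f) - ∑_k ∂_{y_k} (β_k f) + χ f` of the phase function `Φ`. -/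
def regL (χ : Euc nξ → ℂ) (Φ : Triple nx ny nξ → ℝ) (f : Triple nx ny nξ → ℂ) :
    Triple nx ny nξ → ℂ := fun z =>
  -(∑ l, partialD (dirXi l) (fun w => coeffAlpha χ Φ l w * f w) z)
    - (∑ k, partialD (dirY k) (fun w => coeffBeta χ Φ k w * f w) z)
    + χ z.2.2 * f z

/-- The regularized integrand `e^{iΦ} L^κ (a ψ)`. -/
def regIntegrand (χ : Euc nξ → ℂ) (κ : ℕ) (ψ : Euc ny → ℂ)
    (P : (Triple nx ny nξ → ℝ) × (Triple nx ny nξ → ℂ)) : Triple nx ny nξ → ℂ := fun z =>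
  Complex.exp (Complex.I * (P.1 z : ℂ)) * ((regL χ P.1)^[κ] (fun w => P.2 w * ψ w.2.1)) z

/-- `A_{Φ,a}[ψ](x) = ∫_Ξ ∫_Y e^{iΦ} L^κ (a ψ) dy đξ`, with `đξ = (2π)^{-nξ} dξ`. -/
def fioApply (Y : Opens (Euc ny)) (χ : Euc nξ → ℂ) (κ : ℕ) (ψ : Euc ny → ℂ)
    (P : (Triple nx ny nξ → ℝ) × (Triple nx ny nξ → ℂ)) (x : Euc nx) : ℂ :=
  (((2 * Real.pi) ^ nξ : ℝ) : ℂ)⁻¹ *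
    ∫ ξ in punctured nξ, ∫ y in (Y : Set (Euc ny)), regIntegrand χ κ ψ P (x, y, ξ)

end FourierOp

end

/-! Everything rests on counting orders in powers of ⟨ξ⟩. For ‖ξ‖ ≥ 1, homogeneity makes ∂_ξΦ of
order 0 and ∂_yΦ of order 1, and the gradient condition in (y, ξ) gives r ≥ α‖ξ‖², so 1/r has order
-2 together with the expected estimates for its derivatives (`sym_inv_regR`). The coefficients of L
therefore have order 0 in front of ∂_ξ and -1 in front of ∂_y. Since ∂_ξ changes the order by -ρ and
∂_y by δ, each application of L lowers the order by min(1-δ, ρ) (`sym_regL`). An x-derivative of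
e^{iΦ}g costs at most one order, because ∂_xΦ has order 1 (`sym_xTransport`). Starting from aψ of
order d, the choice of κ leaves an integrand of order -(n_ξ+1).

For ‖ξ‖ < 1 the higher ξ-derivatives of Φ may blow up at the origin. There, however, χ = 1 and L is
the identity (`regL_iterate_eqOn_self`), so only x-derivatives of e^{iΦ}aψ occur and the weight is
bounded. Both regimes combine in `exists_bound_wordD_regIntegrand`, which is part (a).

Uniformity and continuity in (Φ, a) come out of the same computation. `SymbolFrame.Good` records
smoothness, a bound that is uniform over seminorm balls, and sequential continuity jointly in
parameter and point; all three survive sums, products, inverses and, in `SymbolFrame.Sym`, a budget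
of derivatives. No difference of regularized integrands has to be expanded.

Part (b) follows from the common majorant: differentiation under the integral gives the regularity
(`contDiffOn_integral_of_dominated`), and dominated convergence along moving points x_n → x gives
convergence of the derivatives, which compactness of K_{X,m̃} upgrades to uniform convergence
(`tendsto_funSeminorm`). -/

noncomputable section

namespace FourierOp

/-! ### Iterated directional derivatives indexed by words. -/

section Words

variable {E F : Type*} [NormedAddCommGroup E] [NormedSpace ℝ E]
  [NormedAddCommGroup F] [NormedSpace ℝ F] {ι : Type*}

/-- The iterated derivative of `f` in the directions listed in `w`, the head outermost. -/
def wordD (e : ι → E) (w : List ι) (f : E → F) : E → F :=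
  w.foldr (fun i g => partialD (e i) g) f

@[simp] theorem wordD_nil (e : ι → E) (f : E → F) : wordD e [] f = f := rfl

@[simp] theorem wordD_cons (e : ι → E) (i : ι) (w : List ι) (f : E → F) :
    wordD e (i :: w) f = partialD (e i) (wordD e w f) := rfl

theorem wordD_append (e : ι → E) (w w' : List ι) (f : E → F) :
    wordD e (w ++ w') f = wordD e w (wordD e w' f) := by
  simp [wordD, List.foldr_append]

theorem wordD_map {ι' : Type*} (e : ι → E) (σ : ι' → ι) (w : List ι') (f : E → F) :
    wordD e (w.map σ) f = wordD (fun i => e (σ i)) w f := by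
  simp [wordD, List.foldr_map]

theorem wordD_replicate (e : ι → E) (i : ι) (n : ℕ) (f : E → F) :
    wordD e (List.replicate n i) f = (partialD (e i))^[n] f := by
  induction n with
  | zero => rfl
  | succ n ih => rw [List.replicate_succ, wordD_cons, ih, Function.iterate_succ_apply']

/-- The word that lists each index `i` with multiplicity `j i`, in increasing order. -/
def multiWord {n : ℕ} (j : Fin n → ℕ) : List (Fin n) :=
  (List.finRange n).flatMap fun i => List.replicate (j i) i

theorem multiD_eq_wordD {n : ℕ} (e : Fin n → E) (j : Fin n → ℕ) (f : E → F) :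
    multiD e j f = wordD e (multiWord j) f := by
  unfold multiD multiWord
  induction List.finRange n with
  | nil => rfl
  | cons i l ih => rw [List.foldr_cons, ih, List.flatMap_cons, wordD_append, wordD_replicate]

theorem length_multiWord {n : ℕ} (j : Fin n → ℕ) : (multiWord j).length = len j := by
  simp [multiWord, len, List.length_flatMap, ← List.ofFn_eq_map, List.sum_ofFn]

theorem count_multiWord {n : ℕ} (j : Fin n → ℕ) (i : Fin n) : (multiWord j).count i = j i := by
  simp [multiWord, List.count_flatMap, Function.comp_def, List.count_replicate,
    ← List.ofFn_eq_map, List.sum_ofFn]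

variable {U : Set E} {f g : E → F}

theorem partialD_congr (hU : IsOpen U) (h : EqOn f g U) (v : E) :
    EqOn (partialD v f) (partialD v g) U := fun z hz => by
  have : f =ᶠ[𝓝 z] g := h.eventuallyEq_of_mem (hU.mem_nhds hz)
  simp only [partialD, this.fderiv_eq]

theorem wordD_congr (hU : IsOpen U) (h : EqOn f g U) (e : ι → E) (w : List ι) :
    EqOn (wordD e w f) (wordD e w g) U := by
  induction w with
  | nil => exact h
  | cons i w ih => exact partialD_congr hU ih _

theorem contDiffOn_partialD (hU : IsOpen U) (h : ContDiffOn ℝ ∞ f U) (v : E) :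
    ContDiffOn ℝ ∞ (partialD v f) U :=
  (h.fderiv_of_isOpen hU (m := ∞) (by simp)).clm_apply contDiffOn_const

theorem contDiffOn_wordD (hU : IsOpen U) (h : ContDiffOn ℝ ∞ f U) (e : ι → E) (w : List ι) :
    ContDiffOn ℝ ∞ (wordD e w f) U := by
  induction w with
  | nil => exact h
  | cons i w ih => exact contDiffOn_partialD hU ih _

theorem differentiableAt_of_contDiffOn (hU : IsOpen U) (h : ContDiffOn ℝ ∞ f U) {z : E}
    (hz : z ∈ U) : DifferentiableAt ℝ f z :=
  (h.contDiffAt (hU.mem_nhds hz)).differentiableAt (by simp)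

theorem partialD_comm (hU : IsOpen U) (h : ContDiffOn ℝ ∞ f U) (v v' : E) :
    EqOn (partialD v (partialD v' f)) (partialD v' (partialD v f)) U := fun z hz => by
  have hc := h.contDiffAt (hU.mem_nhds hz)
  have hs := hc.isSymmSndFDerivAt (by
    simp only [minSmoothness_of_isRCLikeNormedField]; exact WithTop.coe_le_coe.2 le_top)
  have hd : DifferentiableAt ℝ (fderiv ℝ f) z :=
    (hc.fderiv_right (m := ∞) (by simp)).differentiableAt (by simp)
  have key : ∀ a b : E, partialD a (partialD b f) z = fderiv ℝ (fderiv ℝ f) z a b := by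
    intro a b
    change fderiv ℝ (fun x => fderiv ℝ f x b) z a = _
    rw [(hd.hasFDerivAt.clm_apply (hasFDerivAt_const b z)).fderiv]
    simp
  rw [key, key]
  exact hs v v'

/-- Symmetry of second derivatives allows swapping adjacent letters. Inductions can thus prepend
arbitrary letters, and the ordering prescribed by multi-indices is restored only when a seminorm has
to be invoked. -/
theorem wordD_perm (hU : IsOpen U) (h : ContDiffOn ℝ ∞ f U) (e : ι → E) {w w' : List ι}
    (hw : w.Perm w') : EqOn (wordD e w f) (wordD e w' f) U := by
  induction hw with
  | nil => exact fun _ _ => rfl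
  | cons i _ ih => exact partialD_congr hU ih _
  | swap i j l => exact partialD_comm hU (contDiffOn_wordD hU h e l) _ _
  | trans _ _ ih₁ ih₂ => exact ih₁.trans ih₂

theorem partialD_sub {z : E} (hf : DifferentiableAt ℝ f z) (hg : DifferentiableAt ℝ g z) (v : E) :
    partialD v (f - g) z = partialD v f z - partialD v g z := by
  simp [partialD, fderiv_sub hf hg]

theorem wordD_sub (hU : IsOpen U) (hf : ContDiffOn ℝ ∞ f U) (hg : ContDiffOn ℝ ∞ g U)
    (e : ι → E) (w : List ι) : EqOn (wordD e w (f - g)) (wordD e w f - wordD e w g) U := by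
  induction w with
  | nil => exact fun _ _ => rfl
  | cons i w ih =>
    intro z hz
    rw [wordD_cons, partialD_congr hU ih _ hz, partialD_sub
      (differentiableAt_of_contDiffOn hU (contDiffOn_wordD hU hf e w) hz)
      (differentiableAt_of_contDiffOn hU (contDiffOn_wordD hU hg e w) hz)]
    rfl

end Words

/-- The data of a calculus of symbols that depend on a parameter: symbols are smooth on `U`,
they are estimated on `Ω` against powers of `weight`, uniformly over bounded sets of parameters,
and depend continuously on the parameter. Only derivatives in the directions `dirs` are estimated;
the derivative of index `i` changes the order by `wt i`. -/
structure SymbolFrame (Q ι E : Type*) [NormedAddCommGroup E] [NormedSpace ℝ E] where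
  U : Set E
  isOpen : IsOpen U
  Ω : Set E
  subset : Ω ⊆ U
  params : Set Q
  bdd : ℝ → Set Q
  bdd_subset : ∀ R, bdd R ⊆ params
  conv : (ℕ → Q) → Q → Prop
  conv_mem : ∀ Pn P, conv Pn P → (∀ n, Pn n ∈ params) ∧ P ∈ params
  dirs : Set ι
  dir : ι → E
  wt : ι → ℝ
  weight : E → ℝ
  one_le_weight : ∀ z, 1 ≤ weight z

namespace SymbolFrame

variable {Q ι E : Type*} [NormedAddCommGroup E] [NormedSpace ℝ E] {S : SymbolFrame Q ι E}
  {f g : Q → E → ℂ} {μ ν : ℝ} {N : ℕ}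

/-- `f` is smooth on `U`, of order `μ` on `Ω`, and jointly continuous in parameter and point. -/
structure Good (S : SymbolFrame Q ι E) (μ : ℝ) (f : Q → E → ℂ) : Prop where
  smooth : ∀ P ∈ S.params, ContDiffOn ℝ ∞ (f P) S.U
  bound : ∀ R, ∃ C : ℝ, ∀ P ∈ S.bdd R, ∀ z ∈ S.Ω, ‖f P z‖ ≤ C * S.weight z ^ μ
  tendsto : ∀ Pn P, S.conv Pn P → ∀ zn z, z ∈ S.U → Tendsto zn atTop (𝓝 z) →
    Tendsto (fun n => f (Pn n) (zn n)) atTop (𝓝 (f P z))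

/-- The derivatives of `f` of length at most `N` are good, with the expected orders. -/
def Sym (S : SymbolFrame Q ι E) : ℕ → ℝ → (Q → E → ℂ) → Prop
  | 0, μ, f => S.Good μ f
  | N + 1, μ, f =>
    S.Good μ f ∧ ∀ i ∈ S.dirs, S.Sym N (μ + S.wt i) fun P => partialD (S.dir i) (f P)

theorem weight_pos (S : SymbolFrame Q ι E) (z : E) : 0 < S.weight z :=
  zero_lt_one.trans_le (S.one_le_weight z)

theorem Sym.good (h : S.Sym N μ f) : S.Good μ f := by
  cases N with
  | zero => exact h
  | succ N => exact h.1

theorem Good.congr (hf : S.Good μ f) (h : ∀ P ∈ S.params, EqOn (f P) (g P) S.U) :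
    S.Good μ g where
  smooth P hP := (hf.smooth P hP).congr (h P hP).symm
  bound R := by
    obtain ⟨C, hC⟩ := hf.bound R
    refine ⟨C, fun P hP z hz => ?_⟩
    rw [← h P (S.bdd_subset R hP) (S.subset hz)]
    exact hC P hP z hz
  tendsto Pn P hPn zn z hz hzn := by
    have hm := S.conv_mem Pn P hPn
    rw [← h P hm.2 hz]
    refine (hf.tendsto Pn P hPn zn z hz hzn).congr' ?_
    filter_upwards [hzn.eventually (S.isOpen.mem_nhds hz)] with n hn
    exact h _ (hm.1 n) hn

theorem Sym.congr (hf : S.Sym N μ f) (h : ∀ P ∈ S.params, EqOn (f P) (g P) S.U) :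
    S.Sym N μ g := by
  induction N generalizing μ f g with
  | zero => exact Good.congr hf h
  | succ N ih =>
    exact ⟨hf.1.congr h, fun i hi => ih (hf.2 i hi) fun P hP =>
      partialD_congr S.isOpen (h P hP) _⟩

theorem Sym.pred (hf : S.Sym (N + 1) μ f) : S.Sym N μ f := by
  induction N generalizing μ f with
  | zero => exact hf.1
  | succ N ih => exact ⟨hf.1, fun i hi => ih (hf.2 i hi)⟩

theorem Good.mono (hf : S.Good μ f) (h : μ ≤ ν) : S.Good ν f where
  smooth := hf.smooth
  bound R := by
    obtain ⟨C, hC⟩ := hf.bound R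
    refine ⟨|C|, fun P hP z hz => (hC P hP z hz).trans ?_⟩
    have := Real.rpow_le_rpow_of_exponent_le (S.one_le_weight z) h
    have h0 := Real.rpow_nonneg (S.weight_pos z).le μ
    calc C * S.weight z ^ μ ≤ |C| * S.weight z ^ μ := by gcongr; exact le_abs_self C
      _ ≤ _ := by gcongr
  tendsto := hf.tendsto

theorem Sym.mono (hf : S.Sym N μ f) (h : μ ≤ ν) : S.Sym N ν f := by
  induction N generalizing μ ν f with
  | zero => exact Good.mono hf h
  | succ N ih => exact ⟨hf.1.mono h, fun i hi => ih (hf.2 i hi) (by gcongr)⟩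

/-- Where the weight is bounded, the order of a symbol is irrelevant. -/
theorem Good.of_weight_le (hf : S.Good μ f) {B : ℝ} (hB : ∀ z ∈ S.Ω, S.weight z ≤ B) (ν : ℝ) :
    S.Good ν f where
  smooth := hf.smooth
  bound R := by
    obtain ⟨C, hC⟩ := hf.bound R
    refine ⟨|C| * B ^ |μ - ν|, fun P hP z hz => (hC P hP z hz).trans ?_⟩
    have h0 := S.weight_pos z
    have hB1 : 1 ≤ B := (S.one_le_weight z).trans (hB z hz)
    have h1 : S.weight z ^ (μ - ν) ≤ B ^ |μ - ν| :=
      (Real.rpow_le_rpow_of_exponent_le (S.one_le_weight z) (le_abs_self _)).trans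
        (Real.rpow_le_rpow h0.le (hB z hz) (abs_nonneg _))
    calc C * S.weight z ^ μ ≤ |C| * S.weight z ^ μ := by
          gcongr; exact le_abs_self C
      _ = |C| * (S.weight z ^ (μ - ν) * S.weight z ^ ν) := by
          rw [← Real.rpow_add h0]; simp
      _ ≤ |C| * (B ^ |μ - ν| * S.weight z ^ ν) := by gcongr
      _ = _ := by ring
  tendsto := hf.tendsto

theorem Sym.partialD (hf : S.Sym (N + 1) μ f) {i : ι} (hi : i ∈ S.dirs) :
    S.Sym N (μ + S.wt i) fun P => partialD (S.dir i) (f P) := hf.2 i hi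

theorem Sym.differentiableAt (hf : S.Sym N μ f) {P : Q} (hP : P ∈ S.params) {z : E}
    (hz : z ∈ S.U) : DifferentiableAt ℝ (f P) z :=
  differentiableAt_of_contDiffOn S.isOpen (hf.good.smooth P hP) hz

theorem Good.add (hf : S.Good μ f) (hg : S.Good μ g) : S.Good μ fun P z => f P z + g P z where
  smooth P hP := (hf.smooth P hP).add (hg.smooth P hP)
  bound R := by
    obtain ⟨C, hC⟩ := hf.bound R
    obtain ⟨C', hC'⟩ := hg.bound R
    refine ⟨C + C', fun P hP z hz => (norm_add_le _ _).trans ?_⟩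
    rw [add_mul]
    exact add_le_add (hC P hP z hz) (hC' P hP z hz)
  tendsto Pn P h zn z hz hzn := (hf.tendsto Pn P h zn z hz hzn).add (hg.tendsto Pn P h zn z hz hzn)

theorem Sym.add (hf : S.Sym N μ f) (hg : S.Sym N μ g) : S.Sym N μ fun P z => f P z + g P z := by
  induction N generalizing μ f g with
  | zero => exact Good.add hf hg
  | succ N ih =>
    refine ⟨hf.1.add hg.1, fun i hi => (ih (hf.2 i hi) (hg.2 i hi)).congr fun P hP z hz => ?_⟩
    simp only [FourierOp.partialD]
    rw [fderiv_fun_add (hf.differentiableAt hP hz) (hg.differentiableAt hP hz)]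
    rfl

theorem Good.mul (hf : S.Good μ f) (hg : S.Good ν g) :
    S.Good (μ + ν) fun P z => f P z * g P z where
  smooth P hP := (hf.smooth P hP).mul (hg.smooth P hP)
  bound R := by
    obtain ⟨C, hC⟩ := hf.bound R
    obtain ⟨C', hC'⟩ := hg.bound R
    refine ⟨C * C', fun P hP z hz => ?_⟩
    have h1 := hC P hP z hz
    have h2 := hC' P hP z hz
    rw [norm_mul, Real.rpow_add (S.weight_pos z)]
    calc _ ≤ (C * S.weight z ^ μ) * (C' * S.weight z ^ ν) :=
          mul_le_mul h1 h2 (norm_nonneg _) ((norm_nonneg _).trans h1)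
      _ = _ := by ring
  tendsto Pn P h zn z hz hzn := (hf.tendsto Pn P h zn z hz hzn).mul (hg.tendsto Pn P h zn z hz hzn)

/-- Leibniz rule: in each summand the undifferentiated factor is needed with one derivative fewer
than available, so `Sym.pred` closes the induction. -/
theorem Sym.mul (hf : S.Sym N μ f) (hg : S.Sym N ν g) :
    S.Sym N (μ + ν) fun P z => f P z * g P z := by
  induction N generalizing μ ν f g with
  | zero => exact Good.mul hf hg
  | succ N ih =>
    refine ⟨hf.1.mul hg.1, fun i hi => ?_⟩
    have h1 := (ih hf.pred (hg.2 i hi)).mono (ν := μ + ν + S.wt i) (by linarith)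
    have h2 := (ih hg.pred (hf.2 i hi)).mono (ν := μ + ν + S.wt i) (by linarith)
    refine (h1.add h2).congr fun P hP z hz => ?_
    simp only [FourierOp.partialD]
    rw [fderiv_fun_mul (hf.differentiableAt hP hz) (hg.differentiableAt hP hz)]
    simp

theorem sym_zero (N : ℕ) (μ : ℝ) : S.Sym N μ fun _ _ => 0 := by
  have h0 : ∀ μ, S.Good μ fun _ _ => 0 := fun μ =>
    ⟨fun _ _ => contDiffOn_const, fun _ => ⟨0, by simp⟩, fun _ _ _ _ _ _ _ => tendsto_const_nhds⟩
  induction N generalizing μ with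
  | zero => exact h0 μ
  | succ N ih =>
    exact ⟨h0 μ, fun i _ => (ih _).congr fun P _ z _ => by simp [FourierOp.partialD]⟩

theorem sym_const (N : ℕ) (c : ℂ) : S.Sym N 0 fun _ _ => c := by
  have h0 : S.Good 0 fun _ _ => c :=
    ⟨fun _ _ => contDiffOn_const, fun _ => ⟨‖c‖, by simp⟩,
      fun _ _ _ _ _ _ _ => tendsto_const_nhds⟩
  cases N with
  | zero => exact h0
  | succ N => exact ⟨h0, fun i _ => (sym_zero N _).congr fun P _ z _ => by simp [FourierOp.partialD]⟩

theorem Sym.const_mul (hf : S.Sym N μ f) (c : ℂ) : S.Sym N μ fun P z => c * f P z :=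
  ((sym_const N c).mul hf).mono (by simp)

theorem Sym.neg (hf : S.Sym N μ f) : S.Sym N μ fun P z => -f P z :=
  (hf.const_mul (-1)).congr fun P _ z _ => by simp

theorem Sym.sub (hf : S.Sym N μ f) (hg : S.Sym N μ g) : S.Sym N μ fun P z => f P z - g P z :=
  (hf.add hg.neg).congr fun P _ z _ => by simp [sub_eq_add_neg]

theorem Sym.sum {κ : Type*} {s : Finset κ} {F : κ → Q → E → ℂ}
    (h : ∀ k ∈ s, S.Sym N μ (F k)) : S.Sym N μ fun P z => ∑ k ∈ s, F k P z := by
  classical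
  induction s using Finset.induction_on with
  | empty => exact (sym_zero N μ).congr fun P _ z _ => by simp
  | insert a s ha ih =>
    refine ((h a (by simp)).add (ih fun k hk => h k (by simp [hk]))).congr fun P _ z _ => ?_
    simp [Finset.sum_insert ha]

theorem Good.inv (hf : S.Good μ f) (h0 : ∀ P ∈ S.params, ∀ z ∈ S.U, f P z ≠ 0)
    (hb : ∀ R, ∃ c > 0, ∀ P ∈ S.bdd R, ∀ z ∈ S.Ω, c * S.weight z ^ μ ≤ ‖f P z‖) :
    S.Good (-μ) fun P z => (f P z)⁻¹ where
  smooth P hP := (hf.smooth P hP).inv (h0 P hP)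
  bound R := by
    obtain ⟨c, hc, h⟩ := hb R
    refine ⟨c⁻¹, fun P hP z hz => ?_⟩
    have := Real.rpow_pos_of_pos (S.weight_pos z) μ
    rw [norm_inv, Real.rpow_neg (S.weight_pos z).le, ← mul_inv]
    exact inv_anti₀ (by positivity) (h P hP z hz)
  tendsto Pn P h zn z hz hzn :=
    (hf.tendsto Pn P h zn z hz hzn).inv₀ (h0 P (S.conv_mem Pn P h).2 z hz)

/-- The derivative is -f⁻²∂f, whose order -μ - μ + (μ + wt i) is the expected one. Nonvanishing on
`U` serves smoothness and continuity; the quantitative lower bound on `Ω` serves the estimate. -/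
theorem Sym.inv (hf : S.Sym N μ f) (h0 : ∀ P ∈ S.params, ∀ z ∈ S.U, f P z ≠ 0)
    (hb : ∀ R, ∃ c > 0, ∀ P ∈ S.bdd R, ∀ z ∈ S.Ω, c * S.weight z ^ μ ≤ ‖f P z‖) :
    S.Sym N (-μ) fun P z => (f P z)⁻¹ := by
  induction N with
  | zero => exact Good.inv hf h0 hb
  | succ N ih =>
    refine ⟨hf.1.inv h0 hb, fun i hi => ?_⟩
    have h1 := (((ih hf.pred).mul (ih hf.pred)).mul (hf.2 i hi)).neg.mono
      (ν := -μ + S.wt i) (by linarith)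
    refine h1.congr fun P hP z hz => ?_
    simp only [FourierOp.partialD]
    have := ((hasDerivAt_inv (h0 P hP z hz)).comp_hasFDerivAt z
      (hf.differentiableAt hP hz).hasFDerivAt).fderiv
    simp only [Function.comp_def] at this
    rw [this]
    simp [pow_two]

end SymbolFrame

/-! ### The compact exhaustion of an open set. -/

section Exhaustion

variable {n : ℕ} (Z : Opens (Euc n))

theorem exhaustion_subset (m : ℕ) : exhaustion Z m ⊆ Z := fun _ hx => hx.1

theorem exhaustion_mono {m m' : ℕ} (h : m ≤ m') : exhaustion Z m ⊆ exhaustion Z m' :=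
  fun _ hx => ⟨hx.1, hx.2.1.trans (by exact_mod_cast h),
    (ENNReal.inv_le_inv.2 (by exact_mod_cast h)).trans hx.2.2⟩

theorem mem_of_infEDist_pos {x : Euc n} (h : 0 < Metric.infEDist x (Z : Set (Euc n))ᶜ) :
    x ∈ Z := by
  by_contra hx
  exact h.ne' (Metric.infEDist_zero_of_mem (by simpa using hx))

theorem isCompact_exhaustion (m : ℕ) : IsCompact (exhaustion Z m) := by
  have : exhaustion Z m = Metric.closedBall 0 (m : ℝ) ∩
      (fun x => Metric.infEDist x (Z : Set (Euc n))ᶜ) ⁻¹' Ici (m : ℝ≥0∞)⁻¹ := by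
    ext x
    simp only [exhaustion, mem_ofPred_eq, mem_inter_iff, mem_closedBall_zero_iff, mem_preimage,
      mem_Ici, and_iff_right_iff_imp]
    exact fun h => mem_of_infEDist_pos Z ((ENNReal.inv_pos.2 (by simp)).trans_le h.2)
  rw [this]
  exact (isCompact_closedBall _ _).inter_right
    (isClosed_Ici.preimage Metric.continuous_infEDist)

theorem exists_exhaustion_mem_nhds {x : Euc n} (hx : x ∈ Z) : ∃ m, exhaustion Z m ∈ 𝓝 x := by
  have h0 : Metric.infEDist x (Z : Set (Euc n))ᶜ ≠ 0 := by
    rw [Ne, ← Metric.mem_closure_iff_infEDist_zero, Z.isOpen.isClosed_compl.closure_eq]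
    simpa using hx
  obtain ⟨m₁, h₁⟩ := ENNReal.exists_inv_nat_lt h0
  obtain ⟨m₂, h₂⟩ := exists_nat_gt ‖x‖
  refine ⟨max m₁ m₂, ?_⟩
  have a : ∀ᶠ x' in 𝓝 x, (m₁ : ℝ≥0∞)⁻¹ < Metric.infEDist x' (Z : Set (Euc n))ᶜ :=
    Metric.continuous_infEDist.continuousAt.eventually (lt_mem_nhds h₁)
  have b : ∀ᶠ x' in 𝓝 x, ‖x'‖ < m₂ := continuous_norm.continuousAt.eventually (gt_mem_nhds h₂)
  filter_upwards [a, b] with x' h h'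
  refine ⟨mem_of_infEDist_pos Z (pos_of_gt h), h'.le.trans (by simp), le_trans (by simp) h.le⟩

theorem exists_subset_exhaustion {K : Set (Euc n)} (hK : IsCompact K) (h : K ⊆ Z) :
    ∃ m, K ⊆ exhaustion Z m := by
  have hc : K ⊆ ⋃ m, interior (exhaustion Z m) := fun x hx => by
    obtain ⟨m, hm⟩ := exists_exhaustion_mem_nhds Z (h hx)
    exact mem_iUnion.2 ⟨m, mem_interior_iff_mem_nhds.2 hm⟩
  have hd : Directed (· ⊆ ·) fun m => interior (exhaustion Z m) :=
    directed_of_isDirected_le fun _ _ hab => interior_mono (exhaustion_mono Z hab)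
  obtain ⟨m, hm⟩ := hK.elim_directed_cover _ (fun _ => isOpen_interior) hc hd
  exact ⟨m, hm.trans interior_subset⟩

end Exhaustion

theorem bracket_pos {n : ℕ} (ξ : Euc n) : 0 < bracket ξ := Real.sqrt_pos.2 (by positivity)

theorem one_le_bracket {n : ℕ} (ξ : Euc n) : 1 ≤ bracket ξ :=
  Real.one_le_sqrt.2 (by nlinarith [sq_nonneg ‖ξ‖])

theorem norm_le_bracket {n : ℕ} (ξ : Euc n) : ‖ξ‖ ≤ bracket ξ :=
  Real.le_sqrt_of_sq_le (by linarith)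

theorem bracket_le_two_mul {n : ℕ} {ξ : Euc n} (h : 1 ≤ ‖ξ‖) : bracket ξ ≤ 2 * ‖ξ‖ :=
  Real.sqrt_le_iff.2 ⟨by positivity, by nlinarith⟩

theorem continuous_bracket {n : ℕ} : Continuous (bracket : Euc n → ℝ) := by
  unfold bracket; fun_prop

/-- Multiplicities of letters in words over `Idx` are computed with `List.count`, whose lemmas
require a lawful equality test on this sum type. -/
instance lawfulBEqSum {α β : Type*} [BEq α] [BEq β] [LawfulBEq α] [LawfulBEq β] :
    LawfulBEq (α ⊕ β) where
  eq_of_beq {a b} h := by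
    rcases a with a | a <;> rcases b with b | b
    · exact congrArg _ (eq_of_beq (a := a) h)
    · exact (Bool.false_ne_true h).elim
    · exact (Bool.false_ne_true h).elim
    · exact congrArg _ (eq_of_beq (a := a) h)
  rfl {a} := by
    rcases a with a | a
    · exact beq_self_eq_true a
    · exact beq_self_eq_true a

/-! ### Words in the coordinates (x, y, ξ) and their multi-indices. -/

section Coordinates

variable {nx ny nξ : ℕ}

/-- The indices of the coordinates of `(x, y, ξ)`. -/
abbrev Idx (nx ny nξ : ℕ) : Type := Fin nx ⊕ Fin ny ⊕ Fin nξ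

/-- The coordinate directions of `(x, y, ξ)`. -/
def coordDir : Idx nx ny nξ → Triple nx ny nξ
  | .inl i => dirX i
  | .inr (.inl k) => dirY k
  | .inr (.inr l) => dirXi l

/-- The `x`-part of the multi-index of a word. -/
def cntX (w : List (Idx nx ny nξ)) (i : Fin nx) : ℕ := w.count (.inl i)

/-- The `y`-part of the multi-index of a word. -/
def cntY (w : List (Idx nx ny nξ)) (k : Fin ny) : ℕ := w.count (.inr (.inl k))

/-- The `ξ`-part of the multi-index of a word. -/
def cntXi (w : List (Idx nx ny nξ)) (l : Fin nξ) : ℕ := w.count (.inr (.inr l))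

theorem mixedD_eq_wordD {F : Type*} [NormedAddCommGroup F] [NormedSpace ℝ F]
    (j : Fin nx → ℕ) (k : Fin ny → ℕ) (l : Fin nξ → ℕ) (f : Triple nx ny nξ → F) :
    mixedD j k l f = wordD coordDir ((multiWord j).map Sum.inl ++
      ((multiWord k).map (Sum.inr ∘ Sum.inl) ++ (multiWord l).map (Sum.inr ∘ Sum.inr))) f := by
  simp only [mixedD, multiD_eq_wordD, wordD_append, wordD_map]
  rfl

/-- Comparing multiplicities letter by letter suffices. Together with `wordD_perm` this sorts any
word into the x, y, ξ order in which `mixedD` is defined. -/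
theorem perm_multiWord (w : List (Idx nx ny nξ)) :
    w.Perm ((multiWord (cntX w)).map Sum.inl ++
      ((multiWord (cntY w)).map (Sum.inr ∘ Sum.inl) ++
        (multiWord (cntXi w)).map (Sum.inr ∘ Sum.inr))) := by
  refine List.perm_iff_count.2 fun i => ?_
  have hY : Function.Injective (Sum.inr ∘ Sum.inl : Fin ny → Idx nx ny nξ) :=
    Sum.inr_injective.comp Sum.inl_injective
  have hXi : Function.Injective (Sum.inr ∘ Sum.inr : Fin nξ → Idx nx ny nξ) :=
    Sum.inr_injective.comp Sum.inr_injective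
  have h0 : ∀ {α : Type} (l : List α) (f : α → Idx nx ny nξ) (a : Idx nx ny nξ),
      (∀ x, f x ≠ a) → (l.map f).count a = 0 := fun l f a h =>
    List.count_eq_zero.2 fun hm => by
      obtain ⟨x, _, hx⟩ := List.mem_map.1 hm
      exact h x hx
  rcases i with i | i | i
  · rw [List.count_append, List.count_append,
      List.count_map_of_injective _ _ Sum.inl_injective, count_multiWord,
      h0 _ _ _ (by simp), h0 _ _ _ (by simp)]
    rfl
  · have := List.count_map_of_injective (multiWord (cntY w)) _ hY i
    rw [Function.comp_apply] at this
    rw [List.count_append, List.count_append, this, count_multiWord,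
      h0 _ _ _ (by simp), h0 _ _ _ (by simp)]
    simp [cntY]
  · have := List.count_map_of_injective (multiWord (cntXi w)) _ hXi i
    rw [Function.comp_apply] at this
    rw [List.count_append, List.count_append, this, count_multiWord,
      h0 _ _ _ (by simp), h0 _ _ _ (by simp)]
    simp [cntXi]

theorem wordD_eq_mixedD {F : Type*} [NormedAddCommGroup F] [NormedSpace ℝ F]
    {U : Set (Triple nx ny nξ)} (hU : IsOpen U) {f : Triple nx ny nξ → F}
    (hf : ContDiffOn ℝ ∞ f U) (w : List (Idx nx ny nξ)) :
    EqOn (wordD coordDir w f) (mixedD (cntX w) (cntY w) (cntXi w) f) U := by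
  rw [mixedD_eq_wordD]
  exact wordD_perm hU hf _ (perm_multiWord w)

theorem len_cnt (w : List (Idx nx ny nξ)) :
    len (cntX w) + len (cntY w) + len (cntXi w) = w.length := by
  rw [(perm_multiWord w).length_eq]
  simp [length_multiWord, add_assoc]

/-- The change of order that is caused by the derivative of a given index. -/
def idxWt (ρ δ : ℝ) : Idx nx ny nξ → ℝ
  | .inl _ => δ
  | .inr (.inl _) => δ
  | .inr (.inr _) => -ρ

/-- The change of order that is caused by the derivatives listed in a word. -/
def wordWt (ρ δ : ℝ) (w : List (Idx nx ny nξ)) : ℝ :=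
  δ * ((len (cntX w) : ℝ) + len (cntY w)) - ρ * len (cntXi w)

theorem wordWt_nil (ρ δ : ℝ) : wordWt ρ δ ([] : List (Idx nx ny nξ)) = 0 := by
  simp [wordWt, len, cntX, cntY, cntXi]

theorem len_cntXi_cons (i : Idx nx ny nξ) (w : List (Idx nx ny nξ)) :
    len (cntXi (i :: w)) = len (cntXi w) + (match i with | .inr (.inr _) => 1 | _ => 0) := by
  rcases i with i | i | i <;>
    simp [len, cntXi, List.count_cons, Finset.sum_add_distrib]

theorem wordWt_cons (ρ δ : ℝ) (i : Idx nx ny nξ) (w : List (Idx nx ny nξ)) :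
    wordWt ρ δ (i :: w) = wordWt ρ δ w + idxWt ρ δ i := by
  rcases i with i | i | i <;>
    simp [wordWt, idxWt, len, cntX, cntY, cntXi, List.count_cons, Finset.sum_add_distrib] <;>
    ring

end Coordinates

/-! ### Homogeneity of the derivatives of a phase function. -/

section Domain

variable {nx ny nξ : ℕ} {X : Opens (Euc nx)} {Y : Opens (Euc ny)}

theorem isOpen_punctured (n : ℕ) : IsOpen (punctured n) := isOpen_ne

theorem isOpen_domain (X : Opens (Euc nx)) (Y : Opens (Euc ny)) (nξ : ℕ) :
    IsOpen (domain X Y nξ) :=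
  X.isOpen.prod (Y.isOpen.prod (isOpen_punctured nξ))

/-- The dilation `(x, y, ξ) ↦ (x, y, t ξ)`. -/
def dilation (t : ℝ) : Triple nx ny nξ →L[ℝ] Triple nx ny nξ :=
  (ContinuousLinearMap.id ℝ _).prodMap
    ((ContinuousLinearMap.id ℝ _).prodMap (t • ContinuousLinearMap.id ℝ _))

theorem dilation_apply (t : ℝ) (z : Triple nx ny nξ) :
    dilation t z = (z.1, z.2.1, t • z.2.2) := rfl

theorem dilation_mem {t : ℝ} (ht : 0 < t) {z : Triple nx ny nξ} (hz : z ∈ domain X Y nξ) :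
    dilation t z ∈ domain X Y nξ := by
  rw [dilation_apply]
  exact ⟨hz.1, hz.2.1, smul_ne_zero ht.ne' hz.2.2⟩

/-- Each ξ-derivative lowers the degree of homogeneity by one: differentiating the identity for the
shorter word, the chain rule puts a factor t on the left exactly for ξ-directions. The factor is
written t · (t⁻¹)^|l| to avoid a truncated exponent 1 - |l|. -/
theorem wordD_dilation {Φ : Triple nx ny nξ → ℝ} (hΦ : Φ ∈ Mhg X Y nξ)
    (w : List (Idx nx ny nξ)) {t : ℝ} (ht : 0 < t) {z : Triple nx ny nξ}
    (hz : z ∈ domain X Y nξ) :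
    wordD coordDir w Φ (dilation t z) = t * t⁻¹ ^ len (cntXi w) * wordD coordDir w Φ z := by
  induction w generalizing z with
  | nil =>
    rw [dilation_apply]
    simpa [len, cntXi] using hΦ.2 z.1 hz.1 z.2.1 hz.2.1 z.2.2 hz.2.2 t ht
  | cons i w ih =>
    have hU := isOpen_domain X Y nξ
    have hd : ∀ z ∈ domain X Y nξ, DifferentiableAt ℝ (wordD coordDir w Φ) z := fun z hz =>
      differentiableAt_of_contDiffOn hU (contDiffOn_wordD hU hΦ.1 _ w) hz
    have h1 : (fun z => wordD coordDir w Φ (dilation t z)) =ᶠ[𝓝 z]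
        fun z => t * t⁻¹ ^ len (cntXi w) * wordD coordDir w Φ z := by
      filter_upwards [hU.mem_nhds hz] with z hz using ih hz
    have h2 := h1.fderiv_eq (𝕜 := ℝ)
    have h3 : fderiv ℝ (fun z => wordD coordDir w Φ (dilation t z)) z =
        (fderiv ℝ (wordD coordDir w Φ) (dilation t z)).comp (dilation t) :=
      ((hd _ (dilation_mem ht hz)).hasFDerivAt.comp z (dilation t).hasFDerivAt).fderiv
    rw [h3, fderiv_const_mul (hd z hz)] at h2
    have h4 := congrArg (fun T => T (coordDir i)) h2
    simp only [ContinuousLinearMap.comp_apply, _root_.smul_apply, smul_eq_mul] at h4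
    rw [len_cntXi_cons]
    simp only [wordD_cons, partialD]
    rcases i with i | i | i
    · have : dilation t (coordDir (.inl i : Idx nx ny nξ)) = coordDir (.inl i) := by
        simp [dilation_apply, coordDir, dirX]
      rw [this] at h4
      simpa using h4
    · have : dilation t (coordDir (.inr (.inl i) : Idx nx ny nξ)) = coordDir (.inr (.inl i)) := by
        simp [dilation_apply, coordDir, dirY]
      rw [this] at h4
      simpa using h4
    · have : dilation t (coordDir (.inr (.inr i) : Idx nx ny nξ)) =
          t • coordDir (.inr (.inr i)) := by
        simp [dilation_apply, coordDir, dirXi]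
      rw [this, map_smul, smul_eq_mul] at h4
      simp only [pow_succ]
      rw [← mul_right_inj' ht.ne', h4]
      field_simp

end Domain

/-! ### Seminorms as estimates: pointwise bounds, finiteness, convergence. -/

section Seminorms

variable {nx ny nξ : ℕ} {X : Opens (Euc nx)} {Y : Opens (Euc ny)}

/-- The seminorm sees only ‖ξ‖ = 1; homogeneity carries its bound from ξ/‖ξ‖ to every ξ ≠ 0. -/
theorem enorm_wordD_le_phaseSeminorm {Φ : Triple nx ny nξ → ℝ} (hΦ : Φ ∈ Mhg X Y nξ) {m : ℕ}
    {w : List (Idx nx ny nξ)} (hw : w.length ≤ m) {z : Triple nx ny nξ}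
    (hx : z.1 ∈ exhaustion X m) (hy : z.2.1 ∈ exhaustion Y m) (hξ : z.2.2 ∈ punctured nξ) :
    ‖wordD coordDir w Φ z‖ₑ ≤
      ENNReal.ofReal (‖z.2.2‖ * ‖z.2.2‖⁻¹ ^ len (cntXi w)) * phaseSeminorm X Y m Φ := by
  obtain ⟨x, y, ξ⟩ := z
  have ht : 0 < ‖ξ‖ := norm_pos_iff.2 hξ
  have hn : ‖‖ξ‖⁻¹ • ξ‖ = 1 := by rw [norm_smul, norm_inv, norm_norm, inv_mul_cancel₀ ht.ne']
  have hz₀ : ((x, y, ‖ξ‖⁻¹ • ξ) : Triple nx ny nξ) ∈ domain X Y nξ :=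
    ⟨hx.1, hy.1, smul_ne_zero (inv_ne_zero ht.ne') hξ⟩
  have hz : ((x, y, ξ) : Triple nx ny nξ) = dilation ‖ξ‖ (x, y, ‖ξ‖⁻¹ • ξ) := by
    rw [dilation_apply, smul_inv_smul₀ ht.ne']
  rw [hz, wordD_dilation hΦ w ht hz₀, enorm_mul, ← hz,
    Real.enorm_of_nonneg (by positivity), wordD_eq_mixedD (isOpen_domain X Y nξ) hΦ.1 w hz₀]
  gcongr
  unfold phaseSeminorm
  refine le_trans ?_ (le_iSup₂ x hx)
  refine le_trans ?_ (le_iSup₂ y hy)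
  refine le_trans ?_ (le_iSup₂ (‖ξ‖⁻¹ • ξ) hn)
  refine le_trans ?_ (le_iSup _ (cntX w))
  refine le_trans ?_ (le_iSup _ (cntY w))
  exact le_iSup₂_of_le (cntXi w) ((len_cnt w).trans_le hw) le_rfl

theorem enorm_wordD_le_ampSeminorm (d ρ δ : ℝ) {a : Triple nx ny nξ → ℂ}
    (ha : ContDiffOn ℝ ∞ a (domain X Y nξ)) {m : ℕ}
    {w : List (Idx nx ny nξ)} (hw : w.length ≤ m) {z : Triple nx ny nξ}
    (hx : z.1 ∈ exhaustion X m) (hy : z.2.1 ∈ exhaustion Y m) (hξ : z.2.2 ∈ punctured nξ) :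
    ‖wordD coordDir w a z‖ₑ ≤
      ENNReal.ofReal (bracket z.2.2 ^ (d + wordWt ρ δ w)) * ampSeminorm d ρ δ X Y m a := by
  obtain ⟨x, y, ξ⟩ := z
  have hb := bracket_pos ξ
  rw [wordD_eq_mixedD (isOpen_domain X Y nξ) ha w ⟨hx.1, hy.1, hξ⟩]
  have key : ENNReal.ofReal (bracket ξ ^ (-(d + wordWt ρ δ w))) *
      ‖mixedD (cntX w) (cntY w) (cntXi w) a (x, y, ξ)‖ₑ ≤ ampSeminorm d ρ δ X Y m a := by
    have he : -(d + wordWt ρ δ w) = -d + ρ * (len (cntXi w) : ℝ) -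
        δ * ((len (cntX w) : ℝ) + (len (cntY w) : ℝ)) := by
      unfold wordWt; ring
    rw [he]
    unfold ampSeminorm
    refine le_trans ?_ (le_iSup₂ x hx)
    refine le_trans ?_ (le_iSup₂ y hy)
    refine le_trans ?_ (le_iSup₂ ξ hξ)
    refine le_trans ?_ (le_iSup _ (cntX w))
    refine le_trans ?_ (le_iSup _ (cntY w))
    exact le_iSup₂_of_le (cntXi w) ((len_cnt w).trans_le hw) le_rfl
  calc _ = ENNReal.ofReal (bracket ξ ^ (d + wordWt ρ δ w)) *
        (ENNReal.ofReal (bracket ξ ^ (-(d + wordWt ρ δ w))) *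
          ‖mixedD (cntX w) (cntY w) (cntXi w) a (x, y, ξ)‖ₑ) := by
        rw [← mul_assoc, ← ENNReal.ofReal_mul (by positivity), ← Real.rpow_add hb]
        simp
    _ ≤ _ := by gcongr

theorem finite_len_le (nx ny nξ m : ℕ) :
    {t : (Fin nx → ℕ) × (Fin ny → ℕ) × (Fin nξ → ℕ) |
      len t.1 + len t.2.1 + len t.2.2 ≤ m}.Finite := by
  have hle : ∀ {n : ℕ} (j : Fin n → ℕ) (i : Fin n), j i ≤ len j := fun j i =>
    Finset.single_le_sum (f := j) (fun _ _ => Nat.zero_le _) (Finset.mem_univ i)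
  have hfin : ∀ n : ℕ, {j : Fin n → ℕ | len j ≤ m}.Finite := fun n =>
    (Set.finite_Icc 0 fun _ => m).subset fun j (h : len j ≤ m) =>
      ⟨fun _ => Nat.zero_le _, fun i => (hle j i).trans h⟩
  refine ((hfin nx).prod ((hfin ny).prod (hfin nξ))).subset ?_
  rintro ⟨j, k, l⟩ (h : len j + len k + len l ≤ m)
  exact ⟨show len j ≤ m by omega, show len k ≤ m by omega, show len l ≤ m by omega⟩

/-- A bound for each multi-index of length at most `m` gives a common one. -/
theorem exists_common_bound (nx ny nξ m : ℕ)
    (C : (Fin nx → ℕ) → (Fin ny → ℕ) → (Fin nξ → ℕ) → ℝ) :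
    ∃ B : ℝ, ∀ j k l, len j + len k + len l ≤ m → C j k l ≤ B := by
  obtain ⟨B, hB⟩ := ((finite_len_le nx ny nξ m).image fun t => C t.1 t.2.1 t.2.2).bddAbove
  exact ⟨B, fun j k l h => hB ⟨(j, k, l), h, rfl⟩⟩

theorem phaseSeminorm_lt_top {Φ : Triple nx ny nξ → ℝ} (hΦ : Φ ∈ Mhg X Y nξ) (m : ℕ) :
    phaseSeminorm X Y m Φ < ⊤ := by
  have hb : ∀ (j : Fin nx → ℕ) (k : Fin ny → ℕ) (l : Fin nξ → ℕ), ∃ C : ℝ,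
      ∀ z ∈ exhaustion X m ×ˢ exhaustion Y m ×ˢ Metric.sphere (0 : Euc nξ) 1,
        ‖mixedD j k l Φ z‖ ≤ C := fun j k l => by
    refine ((isCompact_exhaustion X m).prod ((isCompact_exhaustion Y m).prod
      (isCompact_sphere 0 1))).exists_bound_of_continuousOn ?_
    rw [mixedD_eq_wordD]
    refine (contDiffOn_wordD (isOpen_domain X Y nξ) hΦ.1 _ _).continuousOn.mono ?_
    rintro ⟨x, y, ξ⟩ ⟨hx, hy, hξ⟩
    exact ⟨hx.1, hy.1, ne_zero_of_mem_unit_sphere ⟨ξ, hξ⟩⟩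
  choose C hC using hb
  obtain ⟨B, hB⟩ := exists_common_bound nx ny nξ m C
  refine lt_of_le_of_lt ?_ (ENNReal.ofReal_lt_top (r := B))
  refine iSup₂_le fun x hx => iSup₂_le fun y hy => iSup₂_le fun ξ hξ =>
    iSup_le fun j => iSup_le fun k => iSup₂_le fun l hl => ?_
  rw [← ofReal_norm]
  exact ENNReal.ofReal_le_ofReal
    ((hC j k l (x, y, ξ) ⟨hx, hy, by simpa using hξ⟩).trans (hB j k l hl))

theorem contDiffOn_of_mem_amplitudes {d ρ δ : ℝ} {a : Triple nx ny nξ → ℂ}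
    (ha : a ∈ amplitudes d ρ δ X Y nξ) : ContDiffOn ℝ ∞ a (domain X Y nξ) := by
  obtain ⟨b, hb, hab⟩ := ha
  exact (hb.1.mono (prod_mono_right (prod_mono_right (subset_univ _)))).congr hab

/-- The symbol estimates of an extension b hold on the compact set K_{X,m} × K_{Y,m}, and
derivatives of a and b agree because the domain is open. Finiteness lets bounds over seminorm balls
apply to every single pair. -/
theorem ampSeminorm_lt_top {d ρ δ : ℝ} {a : Triple nx ny nξ → ℂ}
    (ha : a ∈ amplitudes d ρ δ X Y nξ) (m : ℕ) : ampSeminorm d ρ δ X Y m a < ⊤ := by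
  obtain ⟨b, hb, hab⟩ := ha
  have h := fun j k l => hb.2 j k l (exhaustion X m ×ˢ exhaustion Y m)
    ((isCompact_exhaustion X m).prod (isCompact_exhaustion Y m))
    (prod_mono (exhaustion_subset X m) (exhaustion_subset Y m))
  choose C hC using h
  obtain ⟨B, hB⟩ := exists_common_bound nx ny nξ m C
  refine lt_of_le_of_lt ?_ (ENNReal.ofReal_lt_top (r := B))
  refine iSup₂_le fun x hx => iSup₂_le fun y hy => iSup₂_le fun ξ hξ =>
    iSup_le fun j => iSup_le fun k => iSup₂_le fun l hl => ?_
  have hp := bracket_pos ξ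
  have h1 : mixedD j k l a (x, y, ξ) = mixedD j k l b (x, y, ξ) := by
    rw [mixedD_eq_wordD, mixedD_eq_wordD]
    exact wordD_congr (isOpen_domain X Y nξ) hab _ _ ⟨hx.1, hy.1, hξ⟩
  rw [← ofReal_norm, ← ENNReal.ofReal_mul (by positivity), h1]
  refine ENNReal.ofReal_le_ofReal (le_trans ?_ (hB j k l hl))
  calc _ ≤ bracket ξ ^ (-d + ρ * (len l : ℝ) - δ * ((len j : ℝ) + (len k : ℝ))) *
        (C j k l * bracket ξ ^ (d - ρ * (len l : ℝ) + δ * ((len j : ℝ) + (len k : ℝ)))) := by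
        gcongr
        exact hC j k l x y ⟨hx, hy⟩ ξ
    _ = C j k l * bracket ξ ^ ((-d + ρ * (len l : ℝ) - δ * ((len j : ℝ) + (len k : ℝ))) +
          (d - ρ * (len l : ℝ) + δ * ((len j : ℝ) + (len k : ℝ)))) := by
        rw [mul_left_comm, ← Real.rpow_add hp]
    _ = C j k l := by ring_nf; simp

theorem Mhg_sub {Φ Ψ : Triple nx ny nξ → ℝ} (hΦ : Φ ∈ Mhg X Y nξ) (hΨ : Ψ ∈ Mhg X Y nξ) :
    Φ - Ψ ∈ Mhg X Y nξ :=
  ⟨hΦ.1.sub hΨ.1, fun x hx y hy ξ hξ t ht => by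
    simp only [Pi.sub_apply, hΦ.2 x hx y hy ξ hξ t ht, hΨ.2 x hx y hy ξ hξ t ht]; ring⟩

/-- Convergence of a sequence of functions together with convergence of the argument, from a
bound on the derivatives of the differences. -/
theorem tendsto_wordD {F : Type*} [NormedAddCommGroup F] [NormedSpace ℝ F]
    {f : ℕ → Triple nx ny nξ → F} {g : Triple nx ny nξ → F}
    (hf : ∀ n, ContDiffOn ℝ ∞ (f n) (domain X Y nξ)) (hg : ContDiffOn ℝ ∞ g (domain X Y nξ))
    (w : List (Idx nx ny nξ)) {zn : ℕ → Triple nx ny nξ} {z : Triple nx ny nξ}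
    (hz : z ∈ domain X Y nξ) (hzn : Tendsto zn atTop (𝓝 z)) (p : ℕ → ℕ → ℝ≥0∞)
    (hp : ∀ m, Tendsto (p m) atTop (𝓝 0)) (c : Triple nx ny nξ → ℝ) (hc : ContinuousAt c z)
    (h : ∀ m n, w.length ≤ m → ∀ z : Triple nx ny nξ, z.1 ∈ exhaustion X m →
      z.2.1 ∈ exhaustion Y m → z.2.2 ∈ punctured nξ →
      ‖wordD coordDir w (f n - g) z‖ₑ ≤ ENNReal.ofReal (c z) * p m n) :
    Tendsto (fun n => wordD coordDir w (f n) (zn n)) atTop (𝓝 (wordD coordDir w g z)) := by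
  have hU := isOpen_domain X Y nξ
  obtain ⟨m₁, h₁⟩ := exists_exhaustion_mem_nhds X hz.1
  obtain ⟨m₂, h₂⟩ := exists_exhaustion_mem_nhds Y hz.2.1
  set m := max (max m₁ m₂) w.length
  have e₁ : ∀ᶠ n in atTop, (zn n).1 ∈ exhaustion X m :=
    ((continuous_fst.tendsto z).comp hzn).eventually
      (mem_of_superset h₁ (exhaustion_mono X (by simp [m])))
  have e₂ : ∀ᶠ n in atTop, (zn n).2.1 ∈ exhaustion Y m :=
    (((continuous_fst.comp continuous_snd).tendsto z).comp hzn).eventually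
      (mem_of_superset h₂ (exhaustion_mono Y (by simp [m])))
  have e₃ : ∀ᶠ n in atTop, zn n ∈ domain X Y nξ := hzn.eventually (hU.mem_nhds hz)
  -- The differences tend to zero even at moving points, since eventually all `zn n` lie in one set
  -- of the exhaustion; what remains is continuity of the derivative of g.
  have hD : Tendsto (fun n => wordD coordDir w (f n - g) (zn n)) atTop (𝓝 0) := by
    rw [tendsto_zero_iff_enorm_tendsto_zero]
    have hl : Tendsto (fun n => ENNReal.ofReal (c (zn n)) * p m n) atTop (𝓝 0) := by
      have := ENNReal.Tendsto.mul (ENNReal.tendsto_ofReal (hc.tendsto.comp hzn))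
        (Or.inr ENNReal.zero_ne_top) (hp m) (Or.inr ENNReal.ofReal_ne_top)
      simpa using this
    refine tendsto_of_tendsto_of_tendsto_of_le_of_le' tendsto_const_nhds hl
      (Eventually.of_forall fun _ => zero_le) ?_
    filter_upwards [e₁, e₂, e₃] with n k₁ k₂ k₃
    exact h m n (by simp [m]) (zn n) k₁ k₂ k₃.2.2
  have hG : Tendsto (fun n => wordD coordDir w g (zn n)) atTop (𝓝 (wordD coordDir w g z)) :=
    ((contDiffOn_wordD hU hg _ w).continuousOn.continuousAt (hU.mem_nhds hz)).tendsto.comp hzn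
  have := hD.add hG
  rw [zero_add] at this
  refine this.congr' ?_
  filter_upwards [e₃] with n hn
  rw [wordD_sub hU (hf n) hg _ w hn]
  simp

theorem tendsto_wordD_phase {Φn : ℕ → Triple nx ny nξ → ℝ} {Φ : Triple nx ny nξ → ℝ}
    (hΦn : ∀ n, Φn n ∈ Mhg X Y nξ) (hΦ : Φ ∈ Mhg X Y nξ)
    (h : ∀ m, Tendsto (fun n => phaseSeminorm X Y m (Φn n - Φ)) atTop (𝓝 0))
    (w : List (Idx nx ny nξ)) {zn : ℕ → Triple nx ny nξ} {z : Triple nx ny nξ}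
    (hz : z ∈ domain X Y nξ) (hzn : Tendsto zn atTop (𝓝 z)) :
    Tendsto (fun n => wordD coordDir w (Φn n) (zn n)) atTop (𝓝 (wordD coordDir w Φ z)) := by
  refine tendsto_wordD (fun n => (hΦn n).1) hΦ.1 w hz hzn _ h
    (fun z => ‖z.2.2‖ * ‖z.2.2‖⁻¹ ^ len (cntXi w)) ?_ fun m n hw z hx hy hξ =>
      enorm_wordD_le_phaseSeminorm (Mhg_sub (hΦn n) hΦ) hw hx hy hξ
  have hn : Continuous fun z : Triple nx ny nξ => ‖z.2.2‖ := by fun_prop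
  exact hn.continuousAt.mul ((hn.continuousAt.inv₀ (norm_ne_zero_iff.2 hz.2.2)).pow _)

theorem tendsto_wordD_amp {d ρ δ : ℝ} {an : ℕ → Triple nx ny nξ → ℂ} {a : Triple nx ny nξ → ℂ}
    (han : ∀ n, an n ∈ amplitudes d ρ δ X Y nξ) (ha : a ∈ amplitudes d ρ δ X Y nξ)
    (h : ∀ m, Tendsto (fun n => ampSeminorm d ρ δ X Y m (an n - a)) atTop (𝓝 0))
    (w : List (Idx nx ny nξ)) {zn : ℕ → Triple nx ny nξ} {z : Triple nx ny nξ}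
    (hz : z ∈ domain X Y nξ) (hzn : Tendsto zn atTop (𝓝 z)) :
    Tendsto (fun n => wordD coordDir w (an n) (zn n)) atTop (𝓝 (wordD coordDir w a z)) := by
  have ha' := contDiffOn_of_mem_amplitudes ha
  have han' := fun n => contDiffOn_of_mem_amplitudes (han n)
  refine tendsto_wordD han' ha' w hz hzn _ h (fun z => bracket z.2.2 ^ (d + wordWt ρ δ w)) ?_
    fun m n hw z hx hy hξ => enorm_wordD_le_ampSeminorm d ρ δ ((han' n).sub ha') hw hx hy hξ
  have hn : Continuous fun z : Triple nx ny nξ => bracket z.2.2 :=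
    continuous_bracket.comp (by fun_prop)
  exact hn.continuousAt.rpow_const (Or.inl (bracket_pos _).ne')

end Seminorms

/-! ### The concrete symbol frame and its elementary symbols. -/

/-- The fixed data of a space of pairs (phase function, amplitude). -/
structure FioData (nx ny nξ : ℕ) where
  X : Opens (Euc nx)
  Y : Opens (Euc ny)
  α : ℝ
  d : ℝ
  ρ : ℝ
  δ : ℝ
  α_pos : 0 < α
  δ_nonneg : 0 ≤ δ
  δ_lt_one : δ < 1
  ρ_pos : 0 < ρ
  ρ_le_one : ρ ≤ 1

/-- Pairs (phase function, amplitude). -/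
abbrev FioPair (nx ny nξ : ℕ) : Type := (Triple nx ny nξ → ℝ) × (Triple nx ny nξ → ℂ)

namespace FioData

variable {nx ny nξ : ℕ} (D : FioData nx ny nξ)

/-- The symbol calculus on `K_{X,m} × K_{Y,m} × T`. -/
def frame (m : ℕ) (I : Set (Idx nx ny nξ)) (T : Set (Euc nξ)) :
    SymbolFrame (FioPair nx ny nξ) (Idx nx ny nξ) (Triple nx ny nξ) where
  U := domain D.X D.Y nξ
  isOpen := isOpen_domain _ _ _
  Ω := exhaustion D.X m ×ˢ exhaustion D.Y m ×ˢ (T ∩ punctured nξ)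
  subset := prod_mono (exhaustion_subset _ _)
    (prod_mono (exhaustion_subset _ _) inter_subset_right)
  params := fioSpace D.α D.d D.ρ D.δ D.X D.Y nξ
  bdd R := {P | P ∈ fioSpace D.α D.d D.ρ D.δ D.X D.Y nξ ∧
    phaseSeminorm D.X D.Y m P.1 ≤ ENNReal.ofReal R ∧
    ampSeminorm D.d D.ρ D.δ D.X D.Y m P.2 ≤ ENNReal.ofReal R}
  bdd_subset _ _ h := h.1
  conv Pn P := (∀ n, Pn n ∈ fioSpace D.α D.d D.ρ D.δ D.X D.Y nξ) ∧
    P ∈ fioSpace D.α D.d D.ρ D.δ D.X D.Y nξ ∧ Converges D.d D.ρ D.δ D.X D.Y Pn P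
  conv_mem _ _ h := ⟨h.1, h.2.1⟩
  dirs := I
  dir := coordDir
  wt := idxWt D.ρ D.δ
  weight z := bracket z.2.2
  one_le_weight z := one_le_bracket z.2.2

theorem neg_one_le_idxWt (i : Idx nx ny nξ) : -1 ≤ idxWt D.ρ D.δ i := by
  have := D.δ_nonneg
  have := D.ρ_le_one
  rcases i with i | i | i <;> simp only [idxWt] <;> linarith

theorem idxWt_le_one (i : Idx nx ny nξ) : idxWt D.ρ D.δ i ≤ 1 := by
  have := D.δ_lt_one
  have := D.ρ_pos
  rcases i with i | i | i <;> simp only [idxWt] <;> linarith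

variable {D} {m : ℕ} {I : Set (Idx nx ny nξ)} {T : Set (Euc nξ)} {N : ℕ}

theorem partialD_comp_clm {E F G : Type*} [NormedAddCommGroup E] [NormedSpace ℝ E]
    [NormedAddCommGroup F] [NormedSpace ℝ F] [NormedAddCommGroup G] [NormedSpace ℝ G]
    (L : E →L[ℝ] F) {h : F → G} {z : E} (hh : DifferentiableAt ℝ h (L z)) (v : E) :
    partialD v (fun z => h (L z)) z = partialD (L v) h (L z) := by
  have : fderiv ℝ (fun z => h (L z)) z = (fderiv ℝ h (L z)).comp L :=
    (hh.hasFDerivAt.comp z L.hasFDerivAt).fderiv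
  simp [partialD, this]

theorem partialD_ofReal {E : Type*} [NormedAddCommGroup E] [NormedSpace ℝ E] {f : E → ℝ} {z : E}
    (hf : DifferentiableAt ℝ f z) (v : E) :
    partialD v (fun z => (f z : ℂ)) z = ((partialD v f z : ℝ) : ℂ) := by
  have : fderiv ℝ (fun z => (f z : ℂ)) z = Complex.ofRealCLM.comp (fderiv ℝ f z) :=
    (Complex.ofRealCLM.hasFDerivAt.comp z hf.hasFDerivAt).fderiv
  simp [partialD, this]

/-- The projection to the `y`-variable. -/
def projY : Triple nx ny nξ →L[ℝ] Euc ny :=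
  (ContinuousLinearMap.fst ℝ _ _).comp (ContinuousLinearMap.snd ℝ _ _)

/-- The projection to the `ξ`-variable. -/
def projXi : Triple nx ny nξ →L[ℝ] Euc nξ :=
  (ContinuousLinearMap.snd ℝ _ _).comp (ContinuousLinearMap.snd ℝ _ _)

/-- Compact support in ξ makes any power of ⟨ξ⟩ harmless, so the order is arbitrary, and derivatives
of h are again of this kind. -/
theorem sym_of_xi (N : ℕ) (μ : ℝ) {h : Euc nξ → ℂ} (hh : ContDiff ℝ ∞ h)
    (hc : HasCompactSupport h) : (D.frame m I T).Sym N μ fun _ z => h z.2.2 := by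
  have good : ∀ (μ : ℝ) {h : Euc nξ → ℂ}, ContDiff ℝ ∞ h → HasCompactSupport h →
      (D.frame m I T).Good μ fun _ z => h z.2.2 := fun μ h hh hc => by
    refine ⟨fun _ _ => (hh.comp projXi.contDiff).contDiffOn, fun _ => ?_,
      fun _ _ _ zn z _ hzn => ?_⟩
    · have hb : Continuous fun ξ : Euc nξ => ((bracket ξ ^ (-μ) : ℝ) : ℂ) :=
        Complex.continuous_ofReal.comp
          (continuous_bracket.rpow_const fun ξ => Or.inl (bracket_pos ξ).ne')
      obtain ⟨C, hC⟩ := (hc.mul_right (f' := fun ξ => ((bracket ξ ^ (-μ) : ℝ) : ℂ))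
        ).exists_bound_of_continuous (hh.continuous.mul hb)
      refine ⟨C, fun _ _ z _ => ?_⟩
      have hp := bracket_pos z.2.2
      have h1 := hC z.2.2
      simp only [Pi.mul_apply, norm_mul, Complex.norm_real,
        Real.norm_of_nonneg (Real.rpow_nonneg hp.le _)] at h1
      rw [Real.rpow_neg hp.le] at h1
      exact (mul_inv_le_iff₀ (by positivity)).1 h1
    · exact ((hh.continuous.comp projXi.continuous).tendsto z).comp hzn
  induction N generalizing μ h with
  | zero => exact good μ hh hc
  | succ N ih =>
    refine ⟨good μ hh hc, fun i _ => ?_⟩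
    refine (ih _ (h := partialD (projXi (coordDir i)) h)
      ((hh.fderiv_right (m := ∞) (by simp)).clm_apply contDiff_const)
      (hc.fderiv_apply (𝕜 := ℝ) _)).congr fun _ _ z _ => ?_
    exact (partialD_comp_clm projXi ((hh.differentiable (by simp)) _) _).symm

theorem sym_of_y (N : ℕ) {μ : ℝ} (hμ : 0 ≤ μ) {h : Euc ny → ℂ} (hh : ContDiff ℝ ∞ h)
    (hc : HasCompactSupport h) : (D.frame m I T).Sym N μ fun _ z => h z.2.1 := by
  have good : ∀ {μ : ℝ} {h : Euc ny → ℂ}, 0 ≤ μ → ContDiff ℝ ∞ h → HasCompactSupport h →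
      (D.frame m I T).Good μ fun _ z => h z.2.1 := fun {μ h} hμ hh hc => by
    refine SymbolFrame.Good.mono (μ := 0) ⟨fun _ _ => (hh.comp projY.contDiff).contDiffOn,
      fun _ => ?_, fun _ _ _ zn z _ hzn => ?_⟩ hμ
    · obtain ⟨C, hC⟩ := hc.exists_bound_of_continuous hh.continuous
      exact ⟨C, fun _ _ z _ => by simpa using hC z.2.1⟩
    · exact ((hh.continuous.comp projY.continuous).tendsto z).comp hzn
  induction N generalizing μ h with
  | zero => exact good hμ hh hc
  | succ N ih =>
    refine ⟨good hμ hh hc, fun i _ => ?_⟩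
    have key : ∀ z : Triple nx ny nξ, partialD (coordDir i) (fun z => h z.2.1) z =
        partialD (projY (coordDir i)) h z.2.1 := fun z =>
      partialD_comp_clm projY ((hh.differentiable (by simp)) _) _
    have h0 := D.δ_nonneg
    have hY : 0 ≤ μ + D.δ → (D.frame m I T).Sym N (μ + D.δ) fun _ z =>
        partialD (projY (coordDir i : Triple nx ny nξ)) h z.2.1 := fun hμ' =>
      ih hμ' (h := partialD (projY (coordDir i)) h)
        ((hh.fderiv_right (m := ∞) (by simp)).clm_apply contDiff_const)
        (hc.fderiv_apply (𝕜 := ℝ) _)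
    rcases i with i | i | i
    · exact (hY (by positivity)).congr fun _ _ z _ => (key z).symm
    · exact (hY (by positivity)).congr fun _ _ z _ => (key z).symm
    -- In a ξ-direction the required order may be negative, but the derivative vanishes identically.
    · refine (SymbolFrame.sym_zero _ _).congr fun _ _ z _ => ((key z).trans ?_).symm
      simp [projY, coordDir, dirXi, partialD]

theorem sym_coord (N : ℕ) (l : Fin nξ) :
    (D.frame m I T).Sym N 1 fun _ z => ((z.2.2 l : ℝ) : ℂ) := by
  have hs : ContDiff ℝ ∞ fun z : Triple nx ny nξ => ((z.2.2 l : ℝ) : ℂ) :=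
    Complex.ofRealCLM.contDiff.comp
      ((EuclideanSpace.proj (𝕜 := ℝ) l).contDiff.comp projXi.contDiff)
  have good : (D.frame m I T).Good 1 fun _ z => ((z.2.2 l : ℝ) : ℂ) := by
    refine ⟨fun _ _ => hs.contDiffOn, fun _ => ⟨1, fun _ _ z _ => ?_⟩, fun _ _ _ zn z _ hzn =>
      (hs.continuous.tendsto z).comp hzn⟩
    rw [Complex.norm_real, Real.rpow_one, one_mul]
    exact (PiLp.norm_apply_le z.2.2 l).trans (norm_le_bracket z.2.2)
  cases N with
  | zero => exact good
  | succ N =>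
    refine ⟨good, fun i _ => ?_⟩
    refine ((SymbolFrame.sym_const N (((coordDir i : Triple nx ny nξ).2.2 l : ℝ) : ℂ)).mono
      (ν := 1 + idxWt D.ρ D.δ i) (by linarith [D.neg_one_le_idxWt i])).congr fun _ _ z _ => ?_
    have h1 : (fun z : Triple nx ny nξ => ((z.2.2 l : ℝ) : ℂ)) =
        Complex.ofRealCLM.comp ((EuclideanSpace.proj (𝕜 := ℝ) l).comp projXi) := rfl
    rw [h1]
    simp only [partialD, ContinuousLinearMap.fderiv]
    rfl

theorem sym_normSq (N : ℕ) :
    (D.frame m I T).Sym N 2 fun _ z => ((‖z.2.2‖ ^ 2 : ℝ) : ℂ) := by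
  refine ((SymbolFrame.Sym.sum (s := Finset.univ) fun l _ =>
    (sym_coord N l).mul (sym_coord N l)).mono (by norm_num)).congr fun _ _ z _ => ?_
  rw [EuclideanSpace.real_norm_sq_eq]
  simp [sq]

/-- The true order is 1 - |l|; a derivative changes it by 0 or -1, which is at most the allowance δ
or -ρ because δ ≥ 0 and ρ ≤ 1. The alternatives in `hT` and `hwT` exclude the singularity at ξ = 0:
either ξ stays away from it, or no ξ-derivative ever occurs. -/
theorem sym_wordD_phase (hT : (∀ ξ ∈ T, 1 ≤ ‖ξ‖) ∨ I ⊆ range Sum.inl)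
    {w : List (Idx nx ny nξ)} (hw : w.length + N ≤ m)
    (hwT : (∀ ξ ∈ T, 1 ≤ ‖ξ‖) ∨ len (cntXi w) = 0) {μ : ℝ} (hμ : 1 - (len (cntXi w) : ℝ) ≤ μ) :
    (D.frame m I T).Sym N μ fun P z => ((wordD coordDir w P.1 z : ℝ) : ℂ) := by
  have good : ∀ {w : List (Idx nx ny nξ)}, w.length ≤ m →
      ((∀ ξ ∈ T, 1 ≤ ‖ξ‖) ∨ len (cntXi w) = 0) → ∀ {μ : ℝ}, 1 - (len (cntXi w) : ℝ) ≤ μ →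
      (D.frame m I T).Good μ fun P z => ((wordD coordDir w P.1 z : ℝ) : ℂ) := by
    intro w hw hwT μ hμ
    refine SymbolFrame.Good.mono (μ := 1 - (len (cntXi w) : ℝ)) ⟨fun P hP => ?_, fun R => ?_,
      fun Pn P hP zn z hz hzn => ?_⟩ hμ
    · exact Complex.ofRealCLM.contDiff.comp_contDiffOn
        (contDiffOn_wordD (isOpen_domain _ _ _) hP.1.1.1 _ w)
    -- The power of 2 comes from replacing ‖ξ‖⁻¹ by 2⟨ξ⟩⁻¹, valid for ‖ξ‖ ≥ 1.
    · refine ⟨2 ^ len (cntXi w) * |R|, fun P hP z hz => ?_⟩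
      have hξ : 0 < ‖z.2.2‖ := norm_pos_iff.2 hz.2.2.2
      have hb := bracket_pos z.2.2
      have h1 : ‖wordD coordDir w P.1 z‖ ≤ ‖z.2.2‖ * ‖z.2.2‖⁻¹ ^ len (cntXi w) * |R| := by
        have h2 := enorm_wordD_le_phaseSeminorm hP.1.1.1 hw hz.1 hz.2.1 hz.2.2.2
        have h3 : phaseSeminorm D.X D.Y m P.1 ≤ ENNReal.ofReal |R| :=
          hP.2.1.trans (ENNReal.ofReal_le_ofReal (le_abs_self R))
        have h4 := h2.trans (mul_le_mul_right h3 _)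
        rw [← ENNReal.ofReal_mul (by positivity), ← ofReal_norm] at h4
        exact (ENNReal.ofReal_le_ofReal_iff (by positivity)).1 h4
      have h5 : ‖z.2.2‖⁻¹ ^ len (cntXi w) ≤
          2 ^ len (cntXi w) * (bracket z.2.2)⁻¹ ^ len (cntXi w) := by
        rcases hwT with h | h
        · rw [← mul_pow]
          gcongr
          have := bracket_le_two_mul (h z.2.2 hz.2.2.1)
          field_simp
          linarith
        · simp [h]
      have h6 : bracket z.2.2 ^ (1 - (len (cntXi w) : ℝ)) =
          bracket z.2.2 * (bracket z.2.2)⁻¹ ^ len (cntXi w) := by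
        rw [Real.rpow_sub hb, Real.rpow_one, Real.rpow_natCast, inv_pow, div_eq_mul_inv]
      rw [Complex.norm_real]
      change _ ≤ _ * bracket z.2.2 ^ (1 - (len (cntXi w) : ℝ))
      rw [h6]
      calc _ ≤ _ := h1
        _ ≤ bracket z.2.2 * (2 ^ len (cntXi w) * (bracket z.2.2)⁻¹ ^ len (cntXi w)) * |R| := by
          gcongr
          exact norm_le_bracket _
        _ = _ := by ring
    · exact (Complex.continuous_ofReal.tendsto _).comp
        (tendsto_wordD_phase (fun n => (hP.1 n).1.1) hP.2.1.1.1 (fun m => (hP.2.2 m).1) w hz hzn)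
  induction N generalizing w μ with
  | zero => exact good (by omega) hwT hμ
  | succ N ih =>
    refine ⟨good (by omega) hwT hμ, fun i hi => ?_⟩
    have hwT' : (∀ ξ ∈ T, 1 ≤ ‖ξ‖) ∨ len (cntXi (i :: w)) = 0 := by
      rcases hT with h | h
      · exact Or.inl h
      · refine hwT.imp id fun h0 => ?_
        obtain ⟨k, rfl⟩ := h hi
        simp [len_cntXi_cons, h0]
    have hμ' : 1 - (len (cntXi (i :: w)) : ℝ) ≤ μ + idxWt D.ρ D.δ i := by
      have h0 := D.δ_nonneg
      have h1 := D.ρ_le_one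
      rw [len_cntXi_cons]
      rcases i with i | i | i <;> simp only [idxWt] <;> push_cast <;> linarith
    refine (ih (by simp only [List.length_cons]; omega) hwT' hμ').congr fun P hP z hz => ?_
    exact (partialD_ofReal (differentiableAt_of_contDiffOn (isOpen_domain _ _ _)
      (contDiffOn_wordD (isOpen_domain _ _ _) hP.1.1.1 _ w) hz) _).symm

theorem sym_wordD_amp {w : List (Idx nx ny nξ)} (hw : w.length + N ≤ m) :
    (D.frame m I T).Sym N (D.d + wordWt D.ρ D.δ w) fun P => wordD coordDir w P.2 := by
  have good : ∀ {w : List (Idx nx ny nξ)}, w.length ≤ m →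
      (D.frame m I T).Good (D.d + wordWt D.ρ D.δ w) fun P => wordD coordDir w P.2 := by
    intro w hw
    refine ⟨fun P hP => contDiffOn_wordD (isOpen_domain _ _ _)
      (contDiffOn_of_mem_amplitudes hP.2) _ w, fun R => ⟨|R|, fun P hP z hz => ?_⟩,
      fun Pn P hP zn z hz hzn => ?_⟩
    · have hb := bracket_pos z.2.2
      have h2 := enorm_wordD_le_ampSeminorm D.d D.ρ D.δ (contDiffOn_of_mem_amplitudes hP.1.2)
        hw hz.1 hz.2.1 hz.2.2.2
      have h3 : ampSeminorm D.d D.ρ D.δ D.X D.Y m P.2 ≤ ENNReal.ofReal |R| :=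
        hP.2.2.trans (ENNReal.ofReal_le_ofReal (le_abs_self R))
      have h4 := h2.trans (mul_le_mul_right h3 _)
      rw [← ENNReal.ofReal_mul (by positivity), ← ofReal_norm] at h4
      rw [mul_comm]
      exact (ENNReal.ofReal_le_ofReal_iff (by positivity)).1 h4
    · exact tendsto_wordD_amp (fun n => (hP.1 n).2) hP.2.1.2 (fun m => (hP.2.2 m).2) w hz hzn
  induction N generalizing w with
  | zero => exact good (by omega)
  | succ N ih =>
    refine ⟨good (by omega), fun i _ => ?_⟩
    refine (ih (w := i :: w) (by simp only [List.length_cons]; omega)).mono ?_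
    rw [wordWt_cons, add_assoc]
    rfl

end FioData

/-! ### Locality of L: supports, and the region where χ = 1. -/

section Local

variable {nx ny nξ : ℕ} {χ : Euc nξ → ℂ} {Φ : Triple nx ny nξ → ℝ} {f g : Triple nx ny nξ → ℂ}
  {V : Set (Triple nx ny nξ)}

theorem partialD_eq_zero (hV : IsOpen V) (h : EqOn f 0 V) (v : Triple nx ny nξ) :
    EqOn (partialD v f) 0 V := fun z hz => by
  rw [partialD_congr hV h v hz]
  simp [partialD]

theorem regL_iterate_eqOn_zero (hV : IsOpen V) (h : EqOn f 0 V) (k : ℕ) :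
    EqOn ((regL χ Φ)^[k] f) 0 V := by
  induction k generalizing f with
  | zero => exact h
  | succ k ih =>
    rw [Function.iterate_succ_apply]
    refine ih fun z hz => ?_
    have h1 : ∀ l, partialD (dirXi l) (fun w => coeffAlpha χ Φ l w * f w) z = 0 := fun l =>
      partialD_eq_zero hV (fun w hw => by simp [h hw]) _ hz
    have h2 : ∀ l, partialD (dirY l) (fun w => coeffBeta χ Φ l w * f w) z = 0 := fun l =>
      partialD_eq_zero hV (fun w hw => by simp [h hw]) _ hz
    simp [regL, h1, h2, h hz]

/-- On an open set where χ = 1 the factor 1 - χ kills both kinds of coefficients, so L reduces to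
multiplication by 1. -/
theorem regL_iterate_eqOn_self (hV : IsOpen V) (hχ : ∀ z ∈ V, χ z.2.2 = 1) (h : EqOn f g V)
    (k : ℕ) : EqOn ((regL χ Φ)^[k] f) g V := by
  induction k generalizing f with
  | zero => exact h
  | succ k ih =>
    rw [Function.iterate_succ_apply]
    refine ih fun z hz => ?_
    have h1 : ∀ l, partialD (dirXi l) (fun w => coeffAlpha χ Φ l w * f w) z = 0 := fun l =>
      partialD_eq_zero hV (fun w hw => by simp [coeffAlpha, hχ w hw]) _ hz
    have h2 : ∀ l, partialD (dirY l) (fun w => coeffBeta χ Φ l w * f w) z = 0 := fun l =>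
      partialD_eq_zero hV (fun w hw => by simp [coeffBeta, hχ w hw]) _ hz
    simp [regL, h1, h2, h hz, hχ z hz]

end Local

/-! ### Moving x-derivatives past the oscillating factor. -/

section Transport

variable {nx ny nξ : ℕ}

/-- The amplitude of `∂_x^w (e^{iΦ} g)`. -/
def xTransport (Φ : Triple nx ny nξ → ℝ) (w : List (Fin nx)) (g : Triple nx ny nξ → ℂ) :
    Triple nx ny nξ → ℂ :=
  w.foldr (fun i g z => partialD (dirX i) g z +
    Complex.I * ((partialD (dirX i) Φ z : ℝ) : ℂ) * g z) g

theorem contDiffOn_cexp {U : Set (Triple nx ny nξ)} {Φ : Triple nx ny nξ → ℝ}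
    (hΦ : ContDiffOn ℝ ∞ Φ U) : ContDiffOn ℝ ∞ (fun z => Complex.exp (Complex.I * (Φ z : ℂ))) U :=
  (contDiffOn_const.mul (Complex.ofRealCLM.contDiff.comp_contDiffOn hΦ)).cexp

theorem contDiffOn_xTransport {U : Set (Triple nx ny nξ)} (hU : IsOpen U)
    {Φ : Triple nx ny nξ → ℝ} (hΦ : ContDiffOn ℝ ∞ Φ U) (w : List (Fin nx))
    {g : Triple nx ny nξ → ℂ} (hg : ContDiffOn ℝ ∞ g U) :
    ContDiffOn ℝ ∞ (xTransport Φ w g) U := by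
  induction w with
  | nil => exact hg
  | cons i w ih =>
    exact (contDiffOn_partialD hU ih _).add ((contDiffOn_const.mul
      (Complex.ofRealCLM.contDiff.comp_contDiffOn (contDiffOn_partialD hU hΦ _))).mul ih)

/-- Conjugating ∂ by e^{iΦ} gives ∂ + i∂Φ. The factor e^{iΦ} is kept outside, so estimates only
concern the amplitude. -/
theorem wordD_cexp_mul {U : Set (Triple nx ny nξ)} (hU : IsOpen U)
    {Φ : Triple nx ny nξ → ℝ} (hΦ : ContDiffOn ℝ ∞ Φ U) (w : List (Fin nx))
    {g : Triple nx ny nξ → ℂ} (hg : ContDiffOn ℝ ∞ g U) :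
    EqOn (wordD dirX w fun z => Complex.exp (Complex.I * (Φ z : ℂ)) * g z)
      (fun z => Complex.exp (Complex.I * (Φ z : ℂ)) * xTransport Φ w g z) U := by
  induction w with
  | nil => exact fun _ _ => rfl
  | cons i w ih =>
    intro z hz
    rw [wordD_cons, partialD_congr hU ih _ hz]
    have h1 := (differentiableAt_of_contDiffOn hU hΦ hz).hasFDerivAt
    have h2 := differentiableAt_of_contDiffOn hU (contDiffOn_xTransport hU hΦ w hg) hz
    have h3 : HasFDerivAt (fun z => Complex.exp (Complex.I * (Φ z : ℂ))) _ z :=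
      ((Complex.ofRealCLM.hasFDerivAt.comp z h1).const_mul Complex.I).cexp
    have h4 := (h3.mul h2.hasFDerivAt).fderiv
    change fderiv ℝ (fun z => Complex.exp (Complex.I * (Φ z : ℂ)) * xTransport Φ w g z) z _ = _
    erw [h4]
    simp only [xTransport, List.foldr_cons, partialD]
    simp
    ring

end Transport

/-! ### Orders of r, of the coefficients, of L and of the x-derivatives. -/

namespace FioData

variable {nx ny nξ : ℕ} {D : FioData nx ny nξ} {m : ℕ} {I : Set (Idx nx ny nξ)}
  {T : Set (Euc nξ)} {N : ℕ}

theorem sym_partialD_xi (hT : ∀ ξ ∈ T, 1 ≤ ‖ξ‖) (hN : N + 1 ≤ m) (l : Fin nξ) :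
    (D.frame m I T).Sym N 0 fun P z => ((partialD (dirXi l) P.1 z : ℝ) : ℂ) :=
  sym_wordD_phase (w := [.inr (.inr l)]) (Or.inl hT) (by simp; omega) (Or.inl hT)
    (by simp [len_cntXi_cons])

theorem sym_partialD_y (hT : ∀ ξ ∈ T, 1 ≤ ‖ξ‖) (hN : N + 1 ≤ m) (k : Fin ny) :
    (D.frame m I T).Sym N 1 fun P z => ((partialD (dirY k) P.1 z : ℝ) : ℂ) :=
  sym_wordD_phase (w := [.inr (.inl k)]) (Or.inl hT) (by simp; omega) (Or.inl hT) (by simp)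

theorem sym_partialD_x (hT : (∀ ξ ∈ T, 1 ≤ ‖ξ‖) ∨ I ⊆ range Sum.inl) (hN : N + 1 ≤ m)
    (i : Fin nx) : (D.frame m I T).Sym N 1 fun P z => ((partialD (dirX i) P.1 z : ℝ) : ℂ) :=
  sym_wordD_phase (w := [.inl i]) hT (by simp; omega)
    (Or.inr (by simp [len, cntXi])) (by simp)

theorem sym_regR (hT : ∀ ξ ∈ T, 1 ≤ ‖ξ‖) (hN : N + 1 ≤ m) :
    (D.frame m I T).Sym N 2 fun P z => ((regR P.1 z : ℝ) : ℂ) := by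
  have h1 : (D.frame m I T).Sym N 2 fun P z => ∑ l, ((‖z.2.2‖ ^ 2 : ℝ) : ℂ) *
      (((partialD (dirXi l) P.1 z : ℝ) : ℂ) * ((partialD (dirXi l) P.1 z : ℝ) : ℂ)) :=
    SymbolFrame.Sym.sum fun l _ => ((sym_normSq N).mul
      ((sym_partialD_xi hT hN l).mul (sym_partialD_xi hT hN l))).mono (by norm_num)
  have h2 : (D.frame m I T).Sym N 2 fun P z => ∑ k,
      ((partialD (dirY k) P.1 z : ℝ) : ℂ) * ((partialD (dirY k) P.1 z : ℝ) : ℂ) :=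
    SymbolFrame.Sym.sum fun k _ => ((sym_partialD_y hT hN k).mul
      (sym_partialD_y hT hN k)).mono (by norm_num)
  refine (h1.add h2).congr fun P _ z _ => ?_
  simp only [regR, sq_abs]
  push_cast
  simp only [sq]

/-- This is the gradient condition in (y, ξ) multiplied by ‖ξ‖². It holds on the whole domain, so
1/r is smooth there as well. -/
theorem mul_le_regR {P : FioPair nx ny nξ} (hP : P ∈ fioSpace D.α D.d D.ρ D.δ D.X D.Y nξ)
    {z : Triple nx ny nξ} (hz : z ∈ domain D.X D.Y nξ) : D.α * ‖z.2.2‖ ^ 2 ≤ regR P.1 z := by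
  have h := (hP.1.2 z.1 hz.1 z.2.1 hz.2.1 z.2.2 hz.2.2).2
  have hξ : ‖z.2.2‖ ≠ 0 := norm_ne_zero_iff.2 hz.2.2
  have h1 := mul_le_mul_of_nonneg_right h (sq_nonneg ‖z.2.2‖)
  refine h1.trans (le_of_eq ?_)
  simp only [regR, sq_abs, mul_pow, ← Finset.mul_sum, add_mul]
  field_simp
  ring

theorem sym_inv_regR (hT : ∀ ξ ∈ T, 1 ≤ ‖ξ‖) (hN : N + 1 ≤ m) :
    (D.frame m I T).Sym N (-2) fun P z => ((regR P.1 z : ℝ) : ℂ)⁻¹ := by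
  -- The 4 is the square of the constant in ⟨ξ⟩ ≤ 2‖ξ‖.
  refine (sym_regR hT hN).inv (fun P hP z hz => ?_) fun R => ⟨D.α / 4, ?_, fun P hP z hz => ?_⟩
  · have hξ : 0 < ‖z.2.2‖ := norm_pos_iff.2 hz.2.2
    have hα := D.α_pos
    exact Complex.ofReal_ne_zero.2 ((by positivity : 0 < D.α * ‖z.2.2‖ ^ 2).trans_le
      (mul_le_regR hP hz)).ne'
  · have := D.α_pos
    positivity
  · have hα := D.α_pos
    have h1 := mul_le_regR hP.1 ((D.frame m I T).subset hz)
    have h2 := bracket_le_two_mul (hT _ hz.2.2.1)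
    rw [Complex.norm_real, Real.rpow_two]
    refine le_trans ?_ (h1.trans (le_abs_self _))
    calc D.α / 4 * bracket z.2.2 ^ 2 ≤ D.α / 4 * (2 * ‖z.2.2‖) ^ 2 := by
          gcongr
          exact (bracket_pos _).le
      _ = _ := by ring

variable {χ : Euc nξ → ℂ}

theorem sym_coeffAlpha (hT : ∀ ξ ∈ T, 1 ≤ ‖ξ‖) (hN : N + 1 ≤ m) (hχ : ContDiff ℝ ∞ χ)
    (hc : HasCompactSupport χ) (l : Fin nξ) :
    (D.frame m I T).Sym N 0 fun P z => coeffAlpha χ P.1 l z := by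
  have h1 := (sym_inv_regR (D := D) (I := I) hT hN).const_mul (-Complex.I)
  have h2 := (SymbolFrame.sym_const (S := D.frame m I T) N 1).sub (sym_of_xi N 0 hχ hc)
  have h3 := (sym_normSq (D := D) (m := m) (I := I) (T := T) N).mul (sym_partialD_xi hT hN l)
  refine (((h1.mul h2).mul h3).mono (by norm_num)).congr fun P _ z _ => ?_
  simp [coeffAlpha, div_eq_mul_inv]

theorem sym_coeffBeta (hT : ∀ ξ ∈ T, 1 ≤ ‖ξ‖) (hN : N + 1 ≤ m) (hχ : ContDiff ℝ ∞ χ)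
    (hc : HasCompactSupport χ) (k : Fin ny) :
    (D.frame m I T).Sym N (-1) fun P z => coeffBeta χ P.1 k z := by
  have h1 := (sym_inv_regR (D := D) (I := I) hT hN).const_mul (-Complex.I)
  have h2 := (SymbolFrame.sym_const (S := D.frame m I T) N 1).sub (sym_of_xi N 0 hχ hc)
  refine (((h1.mul h2).mul (sym_partialD_y hT hN k)).mono (by norm_num)).congr fun P _ z _ => ?_
  simp [coeffBeta, div_eq_mul_inv]

/-- The ξ-terms change the order by 0 - ρ, the y-terms by -1 + δ; the gain is the worse of the two.
One derivative of the symbol is spent on L, and the coefficients contain one more derivative of Φ,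
whence `N + 2 ≤ m`. -/
theorem sym_regL (hT : ∀ ξ ∈ T, 1 ≤ ‖ξ‖) (hN : N + 2 ≤ m) (hχ : ContDiff ℝ ∞ χ)
    (hc : HasCompactSupport χ) {μ : ℝ} {f : FioPair nx ny nξ → Triple nx ny nξ → ℂ}
    (hf : (D.frame m univ T).Sym (N + 1) μ f) :
    (D.frame m univ T).Sym N (μ - min (1 - D.δ) D.ρ) fun P => regL χ P.1 (f P) := by
  have h1 : (D.frame m univ T).Sym N (μ - min (1 - D.δ) D.ρ) fun P z =>
      ∑ l, partialD (dirXi l) (fun w => coeffAlpha χ P.1 l w * f P w) z :=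
    SymbolFrame.Sym.sum fun l _ =>
      (((sym_coeffAlpha hT (by omega) hχ hc l).mul hf).partialD (i := .inr (.inr l))
        (mem_univ _)).mono (by
          have := min_le_right (1 - D.δ) D.ρ
          simp only [frame, idxWt]; linarith)
  have h2 : (D.frame m univ T).Sym N (μ - min (1 - D.δ) D.ρ) fun P z =>
      ∑ k, partialD (dirY k) (fun w => coeffBeta χ P.1 k w * f P w) z :=
    SymbolFrame.Sym.sum fun k _ =>
      (((sym_coeffBeta hT (by omega) hχ hc k).mul hf).partialD (i := .inr (.inl k))
        (mem_univ _)).mono (by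
          have := min_le_left (1 - D.δ) D.ρ
          simp only [frame, idxWt]; linarith)
  -- The zeroth-order term achieves the same gain because χ, being compactly supported, may be
  -- assigned any order.
  have h3 := ((sym_of_xi (D := D) (m := m) (I := univ) (T := T) N (-min (1 - D.δ) D.ρ) hχ hc).mul
    hf.pred).mono (ν := μ - min (1 - D.δ) D.ρ) (by linarith)
  exact (h1.neg.sub h2).add h3

theorem sym_regL_iterate (hT : ∀ ξ ∈ T, 1 ≤ ‖ξ‖) (hχ : ContDiff ℝ ∞ χ)
    (hc : HasCompactSupport χ) (k : ℕ) (hN : k + N + 1 ≤ m) {μ : ℝ}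
    {f : FioPair nx ny nξ → Triple nx ny nξ → ℂ} (hf : (D.frame m univ T).Sym (k + N) μ f) :
    (D.frame m univ T).Sym N (μ - k * min (1 - D.δ) D.ρ) fun P => (regL χ P.1)^[k] (f P) := by
  induction k generalizing μ f with
  | zero => simpa using hf
  | succ k ih =>
    have h1 : (D.frame m univ T).Sym (k + N + 1) μ f := by
      rwa [show k + N + 1 = k + 1 + N by ring]
    refine (ih (by omega) (sym_regL hT (by omega) hχ hc h1)).mono ?_
    push_cast
    linarith

theorem sym_xTransport (hT : (∀ ξ ∈ T, 1 ≤ ‖ξ‖) ∨ I ⊆ range Sum.inl) (hI : range Sum.inl ⊆ I)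
    (w : List (Fin nx)) (hN : w.length + N ≤ m) {μ : ℝ}
    {g : FioPair nx ny nξ → Triple nx ny nξ → ℂ} (hg : (D.frame m I T).Sym (w.length + N) μ g) :
    (D.frame m I T).Sym N (μ + w.length) fun P => xTransport P.1 w (g P) := by
  induction w generalizing N with
  | nil => simpa [xTransport] using hg
  | cons i w ih =>
    simp only [List.length_cons] at hN hg
    have h1 := ih (N := N + 1) (by omega) (by rwa [show w.length + (N + 1) = w.length + 1 + N by ring])
    have h2 := (h1.partialD (i := .inl i) (hI ⟨i, rfl⟩)).mono
      (ν := μ + (w.length + 1 : ℕ)) (by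
        have := D.idxWt_le_one (.inl i)
        push_cast
        simp only [frame]
        linarith)
    have h3 := (((sym_partialD_x hT (by omega) i).const_mul Complex.I).mul h1.pred).mono
      (ν := μ + (w.length + 1 : ℕ)) (by push_cast; linarith)
    exact h2.add h3

/-- The modulus is 1 because Φ is real. Only `Good` is claimed: x-derivatives of e^{iΦ} bring down
∂_xΦ of order 1, more than δ, and are accounted for by `xTransport`. -/
theorem good_cexp : (D.frame m I T).Good 0 fun P z =>
    Complex.exp (Complex.I * (P.1 z : ℂ)) := by
  refine ⟨fun P hP => contDiffOn_cexp hP.1.1.1, fun R => ⟨1, fun P hP z hz => ?_⟩,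
    fun Pn P hP zn z hz hzn => ?_⟩
  · rw [mul_comm, Complex.norm_exp_ofReal_mul_I]
    simp
  · exact (by fun_prop : Continuous fun t : ℝ => Complex.exp (Complex.I * (t : ℂ))).tendsto _ |>.comp
      (tendsto_wordD_phase (fun n => (hP.1 n).1.1) hP.2.1.1.1 (fun m => (hP.2.2 m).1) [] hz hzn)

theorem good_wordD_cexp_mul (hT : (∀ ξ ∈ T, 1 ≤ ‖ξ‖) ∨ I ⊆ range Sum.inl)
    (hI : range Sum.inl ⊆ I) (w : List (Fin nx)) (hN : w.length ≤ m) {μ : ℝ}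
    {g : FioPair nx ny nξ → Triple nx ny nξ → ℂ} (hg : (D.frame m I T).Sym w.length μ g) :
    (D.frame m I T).Good (μ + w.length) fun P =>
      wordD dirX w fun z => Complex.exp (Complex.I * (P.1 z : ℂ)) * g P z := by
  refine (good_cexp.mul (sym_xTransport (N := 0) hT hI w hN hg).good).congr
    (fun P hP z hz => (wordD_cexp_mul (isOpen_domain _ _ _) hP.1.1.1 w
      (hg.good.smooth P hP) hz).symm) |>.mono (by simp)

variable {ψ : Euc ny → ℂ}

theorem sym_amp_mul (hψ : ContDiff ℝ ∞ ψ) (hc : HasCompactSupport ψ) (hN : N ≤ m) :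
    (D.frame m I T).Sym N D.d fun P z => P.2 z * ψ z.2.1 :=
  ((sym_wordD_amp (w := []) (by simpa using hN)).mul (sym_of_y N le_rfl hψ hc)).mono
    (by simp [wordWt_nil])

end FioData

/-! ### The estimate of the regularized integrand. -/

namespace FioData

variable {nx ny nξ : ℕ} {D : FioData nx ny nξ} {χ : Euc nξ → ℂ} {ψ : Euc ny → ℂ} {mt κ m : ℕ}

/-- The assumptions on the cut-off `χ`, the test function `ψ` and the number `κ` of
regularizations that are needed for `m̃` derivatives of the regularized integrand. -/
structure Regular (D : FioData nx ny nξ) (χ : Euc nξ → ℂ) (ψ : Euc ny → ℂ) (mt κ : ℕ) : Prop where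
  smooth_χ : ContDiff ℝ ∞ χ
  compact_χ : HasCompactSupport χ
  χ_eq_one : ∀ ξ, ‖ξ‖ < 1 → χ ξ = 1
  smooth_ψ : ContDiff ℝ ∞ ψ
  compact_ψ : HasCompactSupport ψ
  tsupport_ψ : tsupport ψ ⊆ D.Y
  order_le : D.d + (mt : ℝ) - (κ : ℝ) * min (1 - D.δ) D.ρ ≤ -((nξ : ℝ) + 1)

theorem good_wordD_regIntegrand {T : Set (Euc nξ)} (hT : ∀ ξ ∈ T, 1 ≤ ‖ξ‖)
    (hR : D.Regular χ ψ mt κ) (hm : κ + mt + 1 ≤ m) {w : List (Fin nx)} (hw : w.length ≤ mt) :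
    (D.frame m univ T).Good (-((nξ : ℝ) + 1)) fun P => wordD dirX w (regIntegrand χ κ ψ P) := by
  have hw' : (w.length : ℝ) ≤ mt := by exact_mod_cast hw
  exact (good_wordD_cexp_mul (Or.inl hT) (subset_univ _) w (by omega)
    (sym_regL_iterate hT hR.smooth_χ hR.compact_χ κ (by omega)
      (sym_amp_mul hR.smooth_ψ hR.compact_ψ (by omega)))).mono (by linarith [hR.order_le])

/-- Smoothness and sequential continuity in a frame refer to all of `U`, not to `Ω`. The choice `T
:= ∅` thus gives them on the entire domain, with the condition ‖ξ‖ ≥ 1 vacuous;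
`tendsto_wordD_regIntegrand` uses the same choice. -/
theorem contDiffOn_regIntegrand (hR : D.Regular χ ψ mt κ)
    {P : FioPair nx ny nξ} (hP : P ∈ fioSpace D.α D.d D.ρ D.δ D.X D.Y nξ) :
    ContDiffOn ℝ ∞ (regIntegrand χ κ ψ P) (domain D.X D.Y nξ) :=
  (good_wordD_regIntegrand (D := D) (T := ∅) (w := []) (by simp) hR le_rfl
    (Nat.zero_le _)).smooth P hP

theorem tendsto_wordD_regIntegrand (hR : D.Regular χ ψ mt κ)
    {w : List (Fin nx)} (hw : w.length ≤ mt) {Pn : ℕ → FioPair nx ny nξ} {P : FioPair nx ny nξ}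
    (hPn : ∀ n, Pn n ∈ fioSpace D.α D.d D.ρ D.δ D.X D.Y nξ)
    (hP : P ∈ fioSpace D.α D.d D.ρ D.δ D.X D.Y nξ) (h : Converges D.d D.ρ D.δ D.X D.Y Pn P)
    {zn : ℕ → Triple nx ny nξ} {z : Triple nx ny nξ}
    (hz : z ∈ domain D.X D.Y nξ) (hzn : Tendsto zn atTop (𝓝 z)) :
    Tendsto (fun n => wordD dirX w (regIntegrand χ κ ψ (Pn n)) (zn n)) atTop
      (𝓝 (wordD dirX w (regIntegrand χ κ ψ P) z)) :=
  (good_wordD_regIntegrand (D := D) (T := ∅) (by simp) hR le_rfl hw).tendsto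
    Pn P ⟨hPn, hP, h⟩ zn z hz hzn

theorem wordD_regIntegrand_eq_zero (P : FioPair nx ny nξ) (w : List (Fin nx))
    {z : Triple nx ny nξ} (hz : z.2.1 ∉ tsupport ψ) :
    wordD dirX w (regIntegrand χ κ ψ P) z = 0 := by
  have hV : IsOpen {z : Triple nx ny nξ | z.2.1 ∉ tsupport ψ} :=
    (isClosed_tsupport ψ).isOpen_compl.preimage (by fun_prop)
  have h0 : EqOn (regIntegrand χ κ ψ P) 0 {z : Triple nx ny nξ | z.2.1 ∉ tsupport ψ} :=
    fun z hz => by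
      have := regL_iterate_eqOn_zero (χ := χ) (Φ := P.1) hV
        (f := fun w => P.2 w * ψ w.2.1) (fun w hw => by simp [image_eq_zero_of_notMem_tsupport hw])
        κ hz
      simp only [regIntegrand, this]
      simp
  rw [wordD_congr hV h0 _ w hz]
  clear h0
  induction w generalizing z with
  | nil => rfl
  | cons i w ih => exact partialD_eq_zero hV (fun z hz => ih hz) _ hz

/-- For y off the support of ψ the integrand vanishes. Otherwise the symbol calculus applies for ‖ξ‖
≥ 1, and for ‖ξ‖ < 1 the integrand is e^{iΦ}aψ, estimated in a frame that admits x-directions only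
and has weight at most 2. -/
theorem exists_bound_wordD_regIntegrand (hR : D.Regular χ ψ mt κ)
    (hm : κ + mt + 1 ≤ m) (hs : tsupport ψ ⊆ exhaustion D.Y m) {w : List (Fin nx)}
    (hw : w.length ≤ mt) (R : ℝ) :
    ∃ C : ℝ, ∀ P ∈ fioSpace D.α D.d D.ρ D.δ D.X D.Y nξ,
      phaseSeminorm D.X D.Y m P.1 ≤ ENNReal.ofReal R →
      ampSeminorm D.d D.ρ D.δ D.X D.Y m P.2 ≤ ENNReal.ofReal R →
      ∀ x ∈ exhaustion D.X m, ∀ y, ∀ ξ ∈ punctured nξ,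
        ‖wordD dirX w (regIntegrand χ κ ψ P) (x, y, ξ)‖ ≤ C * bracket ξ ^ (-((nξ : ℝ) + 1)) := by
  set V : Set (Triple nx ny nξ) := {z | ‖z.2.2‖ < 1}
  have hV : IsOpen V := isOpen_lt (by fun_prop) continuous_const
  obtain ⟨C₁, h₁⟩ := (good_wordD_regIntegrand (D := D) (T := {ξ | 1 ≤ ‖ξ‖}) (fun _ h => h)
    hR hm hw).bound R
  have h₂ := good_wordD_cexp_mul (D := D) (m := m) (I := range Sum.inl) (T := {ξ | ‖ξ‖ < 1})
    (Or.inr subset_rfl) subset_rfl w (by omega) (sym_amp_mul hR.smooth_ψ hR.compact_ψ (by omega))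
  have hB : ∀ z ∈ (D.frame m (range Sum.inl) {ξ | ‖ξ‖ < 1}).Ω, bracket z.2.2 ≤ 2 := fun z hz => by
    have h1 : ‖z.2.2‖ < 1 := hz.2.2.1
    refine Real.sqrt_le_iff.2 ⟨by norm_num, ?_⟩
    nlinarith [norm_nonneg z.2.2]
  obtain ⟨C₂, h₂⟩ := (h₂.of_weight_le hB (-((nξ : ℝ) + 1))).bound R
  refine ⟨max 0 (max C₁ C₂), fun P hP hp hq x hx y ξ hξ => ?_⟩
  have hb : 0 ≤ bracket ξ ^ (-((nξ : ℝ) + 1)) := Real.rpow_nonneg (bracket_pos ξ).le _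
  by_cases hy : y ∈ tsupport ψ
  · rcases le_or_gt 1 ‖ξ‖ with h | h
    · refine (h₁ P ⟨hP, hp, hq⟩ (x, y, ξ) ⟨hx, hs hy, h, hξ⟩).trans ?_
      exact mul_le_mul_of_nonneg_right ((le_max_left _ _).trans (le_max_right _ _)) hb
    · have he : EqOn (regIntegrand χ κ ψ P)
          (fun z => Complex.exp (Complex.I * (P.1 z : ℂ)) * (P.2 z * ψ z.2.1)) V := fun z hz =>
        congrArg _ (regL_iterate_eqOn_self hV (fun z hz => hR.χ_eq_one _ hz) (fun _ _ => rfl) κ hz)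
      rw [wordD_congr hV he _ w (show (x, y, ξ) ∈ V from h)]
      refine (h₂ P ⟨hP, hp, hq⟩ (x, y, ξ) ⟨hx, hs hy, h, hξ⟩).trans ?_
      exact mul_le_mul_of_nonneg_right ((le_max_right _ _).trans (le_max_right _ _)) hb
  · rw [wordD_regIntegrand_eq_zero P w hy, norm_zero]
    positivity

end FioData

/-! ### Differentiation under the integral sign to order N. -/

section ParametricIntegral

variable {n : ℕ} {Q : Type*} [MeasurableSpace Q] {ν : Measure Q} {X : Set (Euc n)}

/-- The integral of a family of smooth functions, whose derivatives of order at most `N` are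
locally dominated, is of class `C^N` and may be differentiated under the integral. -/
theorem contDiffOn_integral_of_dominated (hX : IsOpen X) (N : ℕ) {G : Euc n → Q → ℂ}
    (hG : ∀ᵐ q ∂ν, ContDiffOn ℝ ∞ (fun x => G x q) X)
    (hm : ∀ w : List (Fin n), w.length ≤ N → ∀ x ∈ X,
      AEStronglyMeasurable (fun q => wordD stdDir w (fun x => G x q) x) ν)
    (hb : ∀ w : List (Fin n), w.length ≤ N → ∀ x ∈ X, ∃ g : Q → ℝ, Integrable g ν ∧
      ∃ u ∈ 𝓝 x, ∀ᵐ q ∂ν, ∀ x ∈ u, ‖wordD stdDir w (fun x => G x q) x‖ ≤ g q) :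
    ContDiffOn ℝ N (fun x => ∫ q, G x q ∂ν) X ∧
    ∀ w : List (Fin n), w.length ≤ N → ∀ x ∈ X,
      wordD stdDir w (fun x => ∫ q, G x q ∂ν) x =
        ∫ q, wordD stdDir w (fun x => G x q) x ∂ν := by
  induction N generalizing G with
  | zero =>
    refine ⟨?_, fun w hw x _ => ?_⟩
    · refine contDiffOn_zero.2 fun x hx => ContinuousAt.continuousWithinAt ?_
      obtain ⟨g, hg, u, hu, hgu⟩ := hb [] le_rfl x hx
      refine continuousAt_of_dominated (bound := g) ?_ ?_ hg ?_
      · filter_upwards [hX.mem_nhds hx] with x hx using hm [] le_rfl x hx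
      · filter_upwards [hu] with x hx
        filter_upwards [hgu] with q hq using hq x hx
      · filter_upwards [hG] with q hq using hq.continuousOn.continuousAt (hX.mem_nhds hx)
    · rw [List.length_eq_zero_iff.1 (Nat.le_zero.1 hw)]
      rfl
  | succ N ih =>
    have hder : ∀ x ∈ X, HasFDerivAt (fun x => ∫ q, G x q ∂ν)
        (∫ q, fderiv ℝ (fun x => G x q) x ∂ν) x ∧
        Integrable (fun q => fderiv ℝ (fun x => G x q) x) ν := by
      intro x hx
      -- Expanding in coordinates reduces measurability and domination of the full derivative to
      -- those of the partial derivatives.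
      have hexp : ∀ T : Euc n →L[ℝ] ℂ, T = ∑ i, (EuclideanSpace.proj (𝕜 := ℝ) i).smulRight
          (T (stdDir i)) := fun T => by
        ext v
        have hv : v = ∑ i, v i • (stdDir i : Euc n) := by
          have := (EuclideanSpace.basisFun (Fin n) ℝ).sum_repr v
          simpa [stdDir, EuclideanSpace.basisFun_apply] using this.symm
        conv_lhs => rw [hv]
        simp
      choose g hg u hu hgu using fun i : Fin n => hb [i] (by simp) x hx
      obtain ⟨g₀, hg₀, u₀, hu₀, hgu₀⟩ := hb [] (by simp) x hx
      set c : Fin n → ℝ := fun i => ‖(EuclideanSpace.proj i : Euc n →L[ℝ] ℝ)‖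
      have hgi : Integrable (fun q => ∑ i, c i * g i q) ν :=
        integrable_finsetSum _ fun i _ => (hg i).const_mul _
      have hmeas : AEStronglyMeasurable (fun q => fderiv ℝ (fun x => G x q) x) ν := by
        have h1 : (fun q => fderiv ℝ (fun x => G x q) x) = fun q =>
            ∑ i, (EuclideanSpace.proj (𝕜 := ℝ) i).smulRight
              (fderiv ℝ (fun x => G x q) x (stdDir i)) := funext fun q => hexp _
        rw [h1]
        refine Finset.aestronglyMeasurable_fun_sum _ fun i _ => ?_
        exact ((ContinuousLinearMap.smulRightL ℝ (Euc n) ℂ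
          (EuclideanSpace.proj (𝕜 := ℝ) i)).continuous).comp_aestronglyMeasurable
          (hm [i] (by simp) x hx)
      have hbound : ∀ᵐ q ∂ν, ∀ x' ∈ X ∩ ⋂ i, u i,
          ‖fderiv ℝ (fun x => G x q) x'‖ ≤ ∑ i, c i * g i q := by
        filter_upwards [ae_all_iff.2 hgu] with q hq x' hx'
        rw [hexp (fderiv ℝ (fun x => G x q) x')]
        refine (norm_sum_le _ _).trans (Finset.sum_le_sum fun i _ => ?_)
        rw [ContinuousLinearMap.norm_smulRight_apply]
        exact mul_le_mul_of_nonneg_left (hq i x' (mem_iInter.1 hx'.2 i)) (norm_nonneg _)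
      have hnhds : X ∩ ⋂ i, u i ∈ 𝓝 x :=
        inter_mem (hX.mem_nhds hx) ((iInter_mem (β := Fin n)).2 hu)
      refine ⟨?_, ?_⟩
      · refine hasFDerivAt_integral_of_dominated_of_fderiv_le
          (F' := fun x q => fderiv ℝ (fun x => G x q) x) hnhds ?_ ?_ hmeas hbound hgi ?_
        · filter_upwards [hX.mem_nhds hx] with x hx using hm [] (by simp) x hx
        · refine hg₀.mono' (hm [] (by simp) x hx) ?_
          filter_upwards [hgu₀] with q hq using hq x (mem_of_mem_nhds hu₀)
        · filter_upwards [hG] with q hq x' hx'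
          exact (differentiableAt_of_contDiffOn hX hq hx'.1).hasFDerivAt
      · refine hgi.mono' hmeas ?_
        filter_upwards [hbound] with q hq using hq x (mem_of_mem_nhds hnhds)
    have hpart : ∀ v : Euc n, EqOn (partialD v fun x => ∫ q, G x q ∂ν)
        (fun x => ∫ q, partialD v (fun x => G x q) x ∂ν) X := fun v x hx => by
      obtain ⟨h1, h2⟩ := hder x hx
      simp only [partialD]
      rw [h1.fderiv, ContinuousLinearMap.integral_apply h2]
    -- The induction hypothesis is applied to ∂_i G, so the new letter is innermost and words grow
    -- at their end; this also dictates the reverse induction on w below.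
    have hi : ∀ i : Fin n, _ := fun i =>
      ih (G := fun x q => partialD (stdDir i) (fun x => G x q) x)
        (by filter_upwards [hG] with q hq using contDiffOn_partialD hX hq _)
        (fun w hw x hx => by
          have := hm (w ++ [i]) (by simpa using hw) x hx
          simpa only [wordD_append, wordD_cons, wordD_nil] using this)
        (fun w hw x hx => by
          have := hb (w ++ [i]) (by simpa using hw) x hx
          simpa only [wordD_append, wordD_cons, wordD_nil] using this)
    refine ⟨?_, fun w hw x hx => ?_⟩
    · push_cast
      refine (contDiffOn_succ_iff_fderiv_of_isOpen hX).2
        ⟨fun x hx => (hder x hx).1.differentiableAt.differentiableWithinAt, by simp, ?_⟩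
      refine contDiffOn_clm_apply.2 fun v => ?_
      have hv : v = ∑ i, v i • (stdDir i : Euc n) := by
        have := (EuclideanSpace.basisFun (Fin n) ℝ).sum_repr v
        simpa [stdDir, EuclideanSpace.basisFun_apply] using this.symm
      have h1 : (fun x => fderiv ℝ (fun x => ∫ q, G x q ∂ν) x v) = fun x =>
          ∑ i, v i • partialD (stdDir i) (fun x => ∫ q, G x q ∂ν) x := by
        funext x
        conv_lhs => rw [hv]
        simp [partialD]
      rw [h1]
      exact ContDiffOn.sum fun i _ => (((hi i).1.congr (hpart _))).const_smul (v i)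
    · induction w using List.reverseRecOn with
      | nil => rfl
      | append_singleton w i =>
        simp only [wordD_append, wordD_cons, wordD_nil]
        rw [wordD_congr hX (hpart (stdDir i)) _ w hx]
        exact (hi i).2 w (by simpa using hw) x hx

end ParametricIntegral

/-! ### Triangle inequalities for the seminorms. -/

section Seminorms

variable {nx ny nξ : ℕ} {X : Opens (Euc nx)} {Y : Opens (Euc ny)}

theorem enorm_mixedD_le {F : Type*} [NormedAddCommGroup F] [NormedSpace ℝ F]
    {f g : Triple nx ny nξ → F} (hf : ContDiffOn ℝ ∞ f (domain X Y nξ))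
    (hg : ContDiffOn ℝ ∞ g (domain X Y nξ)) (j : Fin nx → ℕ) (k : Fin ny → ℕ) (l : Fin nξ → ℕ)
    {z : Triple nx ny nξ} (hz : z ∈ domain X Y nξ) :
    ‖mixedD j k l f z‖ₑ ≤ ‖mixedD j k l (f - g) z‖ₑ + ‖mixedD j k l g z‖ₑ := by
  have h : mixedD j k l f z = mixedD j k l (f - g) z + mixedD j k l g z := by
    simp only [mixedD_eq_wordD]
    rw [wordD_sub (isOpen_domain X Y nξ) hf hg _ _ hz]
    simp
  rw [h]
  exact enorm_add_le _ _

theorem phaseSeminorm_le_add {Φ Ψ : Triple nx ny nξ → ℝ}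
    (hΦ : ContDiffOn ℝ ∞ Φ (domain X Y nξ)) (hΨ : ContDiffOn ℝ ∞ Ψ (domain X Y nξ)) (m : ℕ) :
    phaseSeminorm X Y m Φ ≤ phaseSeminorm X Y m (Φ - Ψ) + phaseSeminorm X Y m Ψ := by
  refine iSup₂_le fun x hx => iSup₂_le fun y hy => iSup₂_le fun ξ hξ =>
    iSup_le fun j => iSup_le fun k => iSup₂_le fun l hl => ?_
  have hξ0 : ξ ≠ 0 := by
    rintro rfl
    simp at hξ
  refine (enorm_mixedD_le hΦ hΨ j k l (z := (x, y, ξ)) ⟨hx.1, hy.1, hξ0⟩).trans ?_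
  have h : ∀ f : Triple nx ny nξ → ℝ, ‖mixedD j k l f (x, y, ξ)‖ₑ ≤ phaseSeminorm X Y m f :=
    fun f => le_iSup₂_of_le x hx <| le_iSup₂_of_le y hy <| le_iSup₂_of_le ξ hξ <|
      le_iSup_of_le j <| le_iSup_of_le k <| le_iSup₂_of_le l hl le_rfl
  exact add_le_add (h _) (h _)

theorem ampSeminorm_le_add {d ρ δ : ℝ} {a b : Triple nx ny nξ → ℂ}
    (ha : ContDiffOn ℝ ∞ a (domain X Y nξ)) (hb : ContDiffOn ℝ ∞ b (domain X Y nξ)) (m : ℕ) :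
    ampSeminorm d ρ δ X Y m a ≤ ampSeminorm d ρ δ X Y m (a - b) + ampSeminorm d ρ δ X Y m b := by
  refine iSup₂_le fun x hx => iSup₂_le fun y hy => iSup₂_le fun ξ hξ =>
    iSup_le fun j => iSup_le fun k => iSup₂_le fun l hl => ?_
  refine (mul_le_mul_right (enorm_mixedD_le ha hb j k l (z := (x, y, ξ)) ⟨hx.1, hy.1, hξ⟩)
    _).trans ?_
  rw [mul_add]
  have h : ∀ f : Triple nx ny nξ → ℂ,
      ENNReal.ofReal (bracket ξ ^ (-d + ρ * (len l : ℝ) - δ * ((len j : ℝ) + (len k : ℝ)))) *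
        ‖mixedD j k l f (x, y, ξ)‖ₑ ≤ ampSeminorm d ρ δ X Y m f :=
    fun f => le_iSup₂_of_le x hx <| le_iSup₂_of_le y hy <| le_iSup₂_of_le ξ hξ <|
      le_iSup_of_le j <| le_iSup_of_le k <| le_iSup₂_of_le l hl le_rfl
  exact add_le_add (h _) (h _)

end Seminorms

/-! ### Dominated integrals over the fibre Y × Ξ. -/

section Slices

variable {nx ny nξ : ℕ} {X : Opens (Euc nx)} {Y : Opens (Euc ny)}

theorem contDiffOn_slice {F : Triple nx ny nξ → ℂ} (hF : ContDiffOn ℝ ∞ F (domain X Y nξ))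
    {q : Euc ny × Euc nξ} (hq : q ∈ (Y : Set (Euc ny)) ×ˢ punctured nξ) :
    ContDiffOn ℝ ∞ (fun x => F (x, q)) X :=
  hF.comp (contDiff_id.prodMk contDiff_const).contDiffOn fun _ hx => ⟨hx, hq⟩

theorem wordD_slice {F : Triple nx ny nξ → ℂ} (hF : ContDiffOn ℝ ∞ F (domain X Y nξ))
    {q : Euc ny × Euc nξ} (hq : q ∈ (Y : Set (Euc ny)) ×ˢ punctured nξ) (w : List (Fin nx)) :
    EqOn (wordD stdDir w fun x => F (x, q)) (fun x => wordD dirX w F (x, q)) X := by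
  induction w with
  | nil => exact fun _ _ => rfl
  | cons i w ih =>
    intro x hx
    have hU := isOpen_domain X Y nξ
    rw [wordD_cons, partialD_congr X.isOpen ih _ hx]
    have h1 := (differentiableAt_of_contDiffOn hU (contDiffOn_wordD hU hF dirX w)
      (z := (x, q)) ⟨hx, hq⟩).hasFDerivAt
    have h2 : HasFDerivAt (fun x => wordD dirX w F (x, q)) _ x :=
      HasFDerivAt.comp x h1 (hasFDerivAt_prodMk_left x q)
    simp only [partialD, wordD_cons]
    rw [h2.fderiv]
    rfl

theorem wordD_const_mul {ι : Type*} {E : Type*} [NormedAddCommGroup E] [NormedSpace ℝ E]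
    {U : Set E} (hU : IsOpen U) {f : E → ℂ} (hf : ContDiffOn ℝ ∞ f U) (c : ℂ) (e : ι → E)
    (w : List ι) : EqOn (wordD e w fun z => c * f z) (fun z => c * wordD e w f z) U := by
  induction w with
  | nil => exact fun _ _ => rfl
  | cons i w ih =>
    intro z hz
    rw [wordD_cons, partialD_congr hU ih _ hz]
    simp only [partialD]
    rw [fderiv_const_mul (differentiableAt_of_contDiffOn hU (contDiffOn_wordD hU hf e w) hz)]
    rfl

/-- `F` is smooth, and its `x`-derivatives of order at most `N` are, locally uniformly in `x`,
dominated by integrable functions of `(y, ξ)`. -/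
structure LocDominated (X : Opens (Euc nx)) (Y : Opens (Euc ny)) (N : ℕ)
    (F : Triple nx ny nξ → ℂ) : Prop where
  smooth : ContDiffOn ℝ ∞ F (domain X Y nξ)
  bound : ∀ w : List (Fin nx), w.length ≤ N → ∀ x ∈ X, ∃ g : Euc ny × Euc nξ → ℝ,
    IntegrableOn g ((Y : Set (Euc ny)) ×ˢ punctured nξ) ∧
    ∃ u ∈ 𝓝 x, ∀ q ∈ (Y : Set (Euc ny)) ×ˢ punctured nξ, ∀ x ∈ u,
      ‖wordD dirX w F (x, q)‖ ≤ g q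

theorem isOpen_fibre (Y : Opens (Euc ny)) (nξ : ℕ) :
    IsOpen ((Y : Set (Euc ny)) ×ˢ punctured nξ) := Y.isOpen.prod (isOpen_punctured nξ)

theorem aestronglyMeasurable_wordD {F : Triple nx ny nξ → ℂ}
    (hF : ContDiffOn ℝ ∞ F (domain X Y nξ)) (w : List (Fin nx)) {x : Euc nx} (hx : x ∈ X) :
    AEStronglyMeasurable (fun q => wordD dirX w F (x, q))
      (volume.restrict ((Y : Set (Euc ny)) ×ˢ punctured nξ)) := by
  refine ContinuousOn.aestronglyMeasurable ?_ (isOpen_fibre Y nξ).measurableSet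
  exact (contDiffOn_wordD (isOpen_domain X Y nξ) hF dirX w).continuousOn.comp
    (by fun_prop) fun q hq => ⟨hx, hq⟩

namespace LocDominated

variable {N : ℕ} {F G : Triple nx ny nξ → ℂ}

theorem integrableOn (hF : LocDominated X Y N F) {x : Euc nx} (hx : x ∈ X) :
    IntegrableOn (fun q => F (x, q)) ((Y : Set (Euc ny)) ×ˢ punctured nξ) := by
  obtain ⟨g, hg, u, hu, h⟩ := hF.bound [] (Nat.zero_le _) x hx
  refine hg.mono' (aestronglyMeasurable_wordD hF.smooth [] hx) ?_
  filter_upwards [ae_restrict_mem (isOpen_fibre Y nξ).measurableSet] with q hq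
  exact h q hq x (mem_of_mem_nhds hu)

theorem integral (hF : LocDominated X Y N F) :
    ContDiffOn ℝ N (fun x => ∫ q in (Y : Set (Euc ny)) ×ˢ punctured nξ, F (x, q)) X ∧
    ∀ w : List (Fin nx), w.length ≤ N → ∀ x ∈ X,
      wordD stdDir w (fun x => ∫ q in (Y : Set (Euc ny)) ×ˢ punctured nξ, F (x, q)) x =
        ∫ q in (Y : Set (Euc ny)) ×ˢ punctured nξ, wordD dirX w F (x, q) := by
  have hmem := ae_restrict_mem (μ := (volume : Measure (Euc ny × Euc nξ)))
    (isOpen_fibre Y nξ).measurableSet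
  have heq : ∀ w : List (Fin nx), ∀ᵐ q ∂volume.restrict ((Y : Set (Euc ny)) ×ˢ punctured nξ),
      ∀ x ∈ X, wordD stdDir w (fun x => F (x, q)) x = wordD dirX w F (x, q) := fun w => by
    filter_upwards [hmem] with q hq x hx using wordD_slice hF.smooth hq w hx
  have h := contDiffOn_integral_of_dominated X.isOpen N (G := fun x q => F (x, q))
    (ν := volume.restrict ((Y : Set (Euc ny)) ×ˢ punctured nξ))
    (by filter_upwards [hmem] with q hq using contDiffOn_slice hF.smooth hq)
    (fun w _ x hx => (aestronglyMeasurable_wordD hF.smooth w hx).congr (by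
      filter_upwards [heq w] with q hq using (hq x hx).symm))
    (fun w hw x hx => by
      obtain ⟨g, hg, u, hu, h⟩ := hF.bound w hw x hx
      -- Derivatives of the slice and partial derivatives of F are identified only over X, so the
      -- neighbourhood is shrunk into X.
      refine ⟨g, hg, u ∩ X, inter_mem hu (X.isOpen.mem_nhds hx), ?_⟩
      filter_upwards [hmem, heq w] with q hq hq' x hx
      rw [hq' x hx.2]
      exact h q hq x hx.1)
  refine ⟨h.1, fun w hw x hx => (h.2 w hw x hx).trans (integral_congr_ae ?_)⟩
  filter_upwards [heq w] with q hq using hq x hx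

theorem const_mul (hF : LocDominated X Y N F) (c : ℂ) :
    LocDominated X Y N fun z => c * F z where
  smooth := contDiffOn_const.mul hF.smooth
  bound w hw x hx := by
    obtain ⟨g, hg, u, hu, h⟩ := hF.bound w hw x hx
    refine ⟨fun q => ‖c‖ * g q, hg.const_mul _, u ∩ X, inter_mem hu (X.isOpen.mem_nhds hx),
      fun q hq x hx => ?_⟩
    rw [wordD_const_mul (isOpen_domain X Y nξ) hF.smooth c dirX w ⟨hx.2, hq⟩, norm_mul]
    exact mul_le_mul_of_nonneg_left (h q hq x hx.1) (norm_nonneg _)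

theorem sub (hF : LocDominated X Y N F) (hG : LocDominated X Y N G) :
    LocDominated X Y N (F - G) where
  smooth := hF.smooth.sub hG.smooth
  bound w hw x hx := by
    obtain ⟨g, hg, u, hu, h⟩ := hF.bound w hw x hx
    obtain ⟨g', hg', u', hu', h'⟩ := hG.bound w hw x hx
    refine ⟨fun q => g q + g' q, hg.add hg', u ∩ u' ∩ X,
      inter_mem (inter_mem hu hu') (X.isOpen.mem_nhds hx), fun q hq x hx => ?_⟩
    rw [wordD_sub (isOpen_domain X Y nξ) hF.smooth hG.smooth dirX w ⟨hx.2, hq⟩]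
    exact (norm_sub_le _ _).trans (add_le_add (h q hq x hx.1.1) (h' q hq x hx.1.2))

end LocDominated

theorem integrable_bracket_rpow (n : ℕ) :
    Integrable fun ξ : Euc n => bracket ξ ^ (-((n : ℝ) + 1)) := by
  have h := integrable_rpow_neg_one_add_norm_sq (E := Euc n) (μ := volume) (r := (n : ℝ) + 1)
    (by simp)
  refine h.congr (Eventually.of_forall fun ξ => ?_)
  simp only [bracket]
  rw [Real.sqrt_eq_rpow, ← Real.rpow_mul (by positivity)]
  congr 1
  ring

/-- The dominating function `C 1_K(y) ⟨ξ⟩^{-(n_ξ+1)}`. -/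
def domFun (K : Set (Euc ny)) (C : ℝ) (q : Euc ny × Euc nξ) : ℝ :=
  K.indicator (fun _ => C) q.1 * bracket q.2 ^ (-((nξ : ℝ) + 1))

theorem integrable_domFun {K : Set (Euc ny)} (hK : IsCompact K) (C : ℝ) :
    Integrable (domFun K C : Euc ny × Euc nξ → ℝ) := by
  have h : Integrable (K.indicator fun _ => C) :=
    (integrable_indicator_iff hK.measurableSet).2
      (integrableOn_const hK.measure_lt_top.ne)
  exact h.mul_prod (integrable_bracket_rpow nξ)

end Slices

/-! ### Regularity and convergence of the oscillatory integral. -/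

namespace FioData

variable {nx ny nξ : ℕ} {D : FioData nx ny nξ} {χ : Euc nξ → ℂ} {ψ : Euc ny → ℂ} {mt κ m : ℕ}

/-- The estimate of `exists_bound_wordD_regIntegrand` with the cut-off in `y`. -/
theorem exists_domFun_bound (hR : D.Regular χ ψ mt κ) (hm : κ + mt + 1 ≤ m)
    (hs : tsupport ψ ⊆ exhaustion D.Y m) {w : List (Fin nx)} (hw : w.length ≤ mt) (R : ℝ) :
    ∃ C : ℝ, ∀ P ∈ fioSpace D.α D.d D.ρ D.δ D.X D.Y nξ,
      phaseSeminorm D.X D.Y m P.1 ≤ ENNReal.ofReal R →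
      ampSeminorm D.d D.ρ D.δ D.X D.Y m P.2 ≤ ENNReal.ofReal R →
      ∀ x ∈ exhaustion D.X m, ∀ q ∈ (D.Y : Set (Euc ny)) ×ˢ punctured nξ,
        ‖wordD dirX w (regIntegrand χ κ ψ P) (x, q)‖ ≤ domFun (tsupport ψ) C q := by
  obtain ⟨C, h⟩ := exists_bound_wordD_regIntegrand hR hm hs hw R
  refine ⟨C, fun P hP hp hq x hx q hq' => ?_⟩
  by_cases hy : q.1 ∈ tsupport ψ
  · simp only [domFun, indicator_of_mem hy]
    exact h P hP hp hq x hx q.1 q.2 hq'.2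
  · rw [wordD_regIntegrand_eq_zero P w hy]
    simp [domFun, hy]

theorem le_ofReal_toReal {a b : ℝ≥0∞} (h : a ≤ b) (hb : b ≠ ⊤) :
    a ≤ ENNReal.ofReal b.toReal := by
  rwa [ENNReal.ofReal_toReal hb]

theorem locDominated_regIntegrand (hR : D.Regular χ ψ mt κ) {P : FioPair nx ny nξ}
    (hP : P ∈ fioSpace D.α D.d D.ρ D.δ D.X D.Y nξ) :
    LocDominated D.X D.Y mt (regIntegrand χ κ ψ P) where
  smooth := contDiffOn_regIntegrand hR hP
  bound w hw x hx := by
    obtain ⟨m₁, h₁⟩ := exists_exhaustion_mem_nhds D.X hx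
    obtain ⟨m₂, h₂⟩ := exists_subset_exhaustion D.Y hR.compact_ψ.isCompact hR.tsupport_ψ
    -- This m makes K_{X,m} a neighbourhood of x, lets K_{Y,m} contain the support of ψ, and
    -- provides enough derivatives for the estimate.
    set m := max (max m₁ m₂) (κ + mt + 1)
    have hp := (phaseSeminorm_lt_top hP.1.1 m).ne
    have hq := (ampSeminorm_lt_top hP.2 m).ne
    have hpq : max (phaseSeminorm D.X D.Y m P.1) (ampSeminorm D.d D.ρ D.δ D.X D.Y m P.2) ≠ ⊤ :=
      (max_lt hp.lt_top hq.lt_top).ne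
    obtain ⟨C, hC⟩ := exists_domFun_bound hR (m := m) (by simp [m])
      (h₂.trans (exhaustion_mono _ (by simp [m]))) hw _
    exact ⟨_, (integrable_domFun hR.compact_ψ.isCompact C).integrableOn, exhaustion D.X m,
      mem_of_superset h₁ (exhaustion_mono _ (by simp [m])), fun q hq x hx =>
      hC P hP (le_ofReal_toReal (le_max_left _ _) hpq) (le_ofReal_toReal (le_max_right _ _) hpq)
        x hx q hq⟩

/-- Fubini, justified by the integrable majorant, with the constant moved inside so that the
integral lemmas apply directly. -/
theorem fioApply_eq (hR : D.Regular χ ψ mt κ) {P : FioPair nx ny nξ}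
    (hP : P ∈ fioSpace D.α D.d D.ρ D.δ D.X D.Y nξ) {x : Euc nx} (hx : x ∈ D.X) :
    fioApply D.Y χ κ ψ P x = ∫ q in (D.Y : Set (Euc ny)) ×ˢ punctured nξ,
      (((2 * Real.pi) ^ nξ : ℝ) : ℂ)⁻¹ * regIntegrand χ κ ψ P (x, q) := by
  have h := (locDominated_regIntegrand hR hP).integrableOn hx
  rw [fioApply, integral_const_mul]
  congr 1
  rw [IntegrableOn, Measure.volume_eq_prod, ← Measure.prod_restrict] at h
  rw [Measure.volume_eq_prod, ← Measure.prod_restrict, integral_prod_symm _ h]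

theorem contDiffOn_fioApply (hR : D.Regular χ ψ mt κ) {P : FioPair nx ny nξ}
    (hP : P ∈ fioSpace D.α D.d D.ρ D.δ D.X D.Y nξ) :
    ContDiffOn ℝ mt (fioApply D.Y χ κ ψ P) D.X :=
  ((locDominated_regIntegrand hR hP).const_mul _).integral.1.congr fun _ hx => fioApply_eq hR hP hx

theorem wordD_fioApply_sub (hR : D.Regular χ ψ mt κ) {P P' : FioPair nx ny nξ}
    (hP : P ∈ fioSpace D.α D.d D.ρ D.δ D.X D.Y nξ) (hP' : P' ∈ fioSpace D.α D.d D.ρ D.δ D.X D.Y nξ)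
    {w : List (Fin nx)} (hw : w.length ≤ mt) {x : Euc nx} (hx : x ∈ D.X) :
    wordD stdDir w (fioApply D.Y χ κ ψ P - fioApply D.Y χ κ ψ P') x =
      (((2 * Real.pi) ^ nξ : ℝ) : ℂ)⁻¹ * ∫ q in (D.Y : Set (Euc ny)) ×ˢ punctured nξ,
        (wordD dirX w (regIntegrand χ κ ψ P) (x, q) -
          wordD dirX w (regIntegrand χ κ ψ P') (x, q)) := by
  set c : ℂ := (((2 * Real.pi) ^ nξ : ℝ) : ℂ)⁻¹ with hc
  have hF := locDominated_regIntegrand hR hP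
  have hF' := locDominated_regIntegrand hR hP'
  have hG := (hF.sub hF').const_mul c
  have h1 : EqOn (fioApply D.Y χ κ ψ P - fioApply D.Y χ κ ψ P')
      (fun x => ∫ q in (D.Y : Set (Euc ny)) ×ˢ punctured nξ,
        c * (regIntegrand χ κ ψ P - regIntegrand χ κ ψ P') (x, q)) D.X := fun x hx => by
    rw [Pi.sub_apply, fioApply_eq hR hP hx, fioApply_eq hR hP' hx,
      ← integral_sub ((hF.integrableOn hx).const_mul _) ((hF'.integrableOn hx).const_mul _)]
    simp only [Pi.sub_apply, mul_sub, hc]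
  rw [wordD_congr D.X.isOpen h1 _ w hx, hG.integral.2 w hw x hx, ← integral_const_mul]
  refine setIntegral_congr_fun (isOpen_fibre D.Y nξ).measurableSet fun q hq => ?_
  have hU := isOpen_domain D.X D.Y nξ
  have hz : ((x, q) : Triple nx ny nξ) ∈ domain D.X D.Y nξ := ⟨hx, hq⟩
  exact (wordD_const_mul hU (hF.sub hF').smooth c dirX w hz).trans
    (congrArg (c * ·) (wordD_sub hU hF.smooth hF'.smooth dirX w hz))

/-- Eventually each seminorm exceeds that of the limit by at most 1. This puts the tail into one
ball, hence under one majorant. -/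
theorem eventually_seminorms_le {Pn : ℕ → FioPair nx ny nξ} {P : FioPair nx ny nξ}
    (hPn : ∀ n, Pn n ∈ fioSpace D.α D.d D.ρ D.δ D.X D.Y nξ)
    (hP : P ∈ fioSpace D.α D.d D.ρ D.δ D.X D.Y nξ) (h : Converges D.d D.ρ D.δ D.X D.Y Pn P)
    (m : ℕ) : ∃ R : ℝ, ∀ᶠ n in atTop, phaseSeminorm D.X D.Y m (Pn n).1 ≤ ENNReal.ofReal R ∧
      ampSeminorm D.d D.ρ D.δ D.X D.Y m (Pn n).2 ≤ ENNReal.ofReal R := by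
  have hp := phaseSeminorm_lt_top hP.1.1 m
  have hq := ampSeminorm_lt_top hP.2 m
  have ht : 1 + max (phaseSeminorm D.X D.Y m P.1) (ampSeminorm D.d D.ρ D.δ D.X D.Y m P.2) ≠ ⊤ :=
    (ENNReal.add_lt_top.2 ⟨ENNReal.one_lt_top, max_lt hp hq⟩).ne
  refine ⟨(1 + max (phaseSeminorm D.X D.Y m P.1)
    (ampSeminorm D.d D.ρ D.δ D.X D.Y m P.2)).toReal, ?_⟩
  filter_upwards [ENNReal.tendsto_nhds_zero.1 (h m).1 1 one_pos,
    ENNReal.tendsto_nhds_zero.1 (h m).2 1 one_pos] with n h1 h2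
  exact ⟨le_ofReal_toReal ((phaseSeminorm_le_add (hPn n).1.1.1 hP.1.1.1 m).trans
      (add_le_add h1 (le_max_left _ _))) ht,
    le_ofReal_toReal ((ampSeminorm_le_add (contDiffOn_of_mem_amplitudes (hPn n).2)
      (contDiffOn_of_mem_amplitudes hP.2) m).trans (add_le_add h2 (le_max_right _ _))) ht⟩

/-- Sequential form of the locally uniform convergence of the derivatives of `A_{Φ_n,a_n}[ψ]`. -/
theorem tendsto_wordD_fioApply_sub_of_tendsto (hR : D.Regular χ ψ mt κ)
    {Pn : ℕ → FioPair nx ny nξ} {P : FioPair nx ny nξ}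
    (hPn : ∀ n, Pn n ∈ fioSpace D.α D.d D.ρ D.δ D.X D.Y nξ)
    (hP : P ∈ fioSpace D.α D.d D.ρ D.δ D.X D.Y nξ) (h : Converges D.d D.ρ D.δ D.X D.Y Pn P)
    {w : List (Fin nx)} (hw : w.length ≤ mt) {xn : ℕ → Euc nx} {x : Euc nx}
    (hxn : ∀ n, xn n ∈ D.X) (hx : x ∈ D.X) (ht : Tendsto xn atTop (𝓝 x)) :
    Tendsto (fun n => wordD stdDir w (fioApply D.Y χ κ ψ (Pn n) - fioApply D.Y χ κ ψ P) (xn n))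
      atTop (𝓝 0) := by
  simp_rw [fun n => wordD_fioApply_sub hR (hPn n) hP hw (hxn n)]
  rw [← mul_zero (((2 * Real.pi) ^ nξ : ℝ) : ℂ)⁻¹]
  refine Tendsto.const_mul _ ?_
  have hfib := ae_restrict_mem (μ := (volume : Measure (Euc ny × Euc nξ)))
    (isOpen_fibre D.Y nξ).measurableSet
  have hU := isOpen_domain D.X D.Y nξ
  have hsm := contDiffOn_regIntegrand (κ := κ) hR hP
  obtain ⟨m₁, h₁⟩ := exists_exhaustion_mem_nhds D.X hx
  obtain ⟨m₂, h₂⟩ := exists_subset_exhaustion D.Y hR.compact_ψ.isCompact hR.tsupport_ψ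
  set m := max (max m₁ m₂) (κ + mt + 1)
  have hs : tsupport ψ ⊆ exhaustion D.Y m := h₂.trans (exhaustion_mono _ (by simp [m]))
  obtain ⟨R, hRn⟩ := eventually_seminorms_le hPn hP h m
  have hpq : max (phaseSeminorm D.X D.Y m P.1) (ampSeminorm D.d D.ρ D.δ D.X D.Y m P.2) ≠ ⊤ :=
    (max_lt (phaseSeminorm_lt_top hP.1.1 m) (ampSeminorm_lt_top hP.2 m)).ne
  obtain ⟨C, hC⟩ := exists_domFun_bound hR (m := m) (by simp [m]) hs hw R
  obtain ⟨C', hC'⟩ := exists_domFun_bound hR (m := m) (by simp [m]) hs hw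
    (max (phaseSeminorm D.X D.Y m P.1) (ampSeminorm D.d D.ρ D.δ D.X D.Y m P.2)).toReal
  rw [← integral_zero (Euc ny × Euc nξ) ℂ
    (μ := volume.restrict ((D.Y : Set (Euc ny)) ×ˢ punctured nξ))]
  refine tendsto_integral_filter_of_dominated_convergence
    (fun q => domFun (tsupport ψ) C q + domFun (tsupport ψ) C' q) ?_ ?_ ?_ ?_
  · exact Eventually.of_forall fun n =>
      (aestronglyMeasurable_wordD (contDiffOn_regIntegrand hR (hPn n)) w (hxn n)).sub
        (aestronglyMeasurable_wordD hsm w (hxn n))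
  · filter_upwards [hRn, ht.eventually (mem_of_superset h₁ (exhaustion_mono _ (by simp [m])) :
      exhaustion D.X m ∈ 𝓝 x)] with n hn hxm
    filter_upwards [hfib] with q hq
    exact (norm_sub_le _ _).trans (add_le_add (hC _ (hPn n) hn.1 hn.2 _ hxm q hq)
      (hC' P hP (le_ofReal_toReal (le_max_left _ _) hpq) (le_ofReal_toReal (le_max_right _ _) hpq)
        _ hxm q hq))
  · exact ((integrable_domFun hR.compact_ψ.isCompact C).add
      (integrable_domFun hR.compact_ψ.isCompact C')).integrableOn
  · filter_upwards [hfib] with q hq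
    have hz : ((x, q) : Triple nx ny nξ) ∈ domain D.X D.Y nξ := ⟨hx, hq⟩
    have hzn : Tendsto (fun n => ((xn n, q) : Triple nx ny nξ)) atTop (𝓝 (x, q)) :=
      ht.prodMk_nhds tendsto_const_nhds
    -- Both terms tend to the value for the limit pair at x: the first by joint continuity in
    -- parameter and point, the second by continuity in the point.
    have a := tendsto_wordD_regIntegrand hR hw hPn hP h hz hzn
    have b := (((contDiffOn_wordD hU hsm dirX w).continuousOn.continuousAt
      (hU.mem_nhds hz)).tendsto.comp hzn)
    have := a.sub b
    rwa [sub_self] at this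

/-- Sequential convergence along every sequence in a compact set implies uniform convergence. A
subsequence argument first removes the assumption that the points converge. -/
theorem tendsto_funSeminorm (hR : D.Regular χ ψ mt κ)
    {Pn : ℕ → FioPair nx ny nξ} {P : FioPair nx ny nξ}
    (hPn : ∀ n, Pn n ∈ fioSpace D.α D.d D.ρ D.δ D.X D.Y nξ)
    (hP : P ∈ fioSpace D.α D.d D.ρ D.δ D.X D.Y nξ) (h : Converges D.d D.ρ D.δ D.X D.Y Pn P) :
    Tendsto (fun n => funSeminorm D.X mt (fioApply D.Y χ κ ψ (Pn n) - fioApply D.Y χ κ ψ P))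
      atTop (𝓝 0) := by
  have hseq : ∀ w : List (Fin nx), w.length ≤ mt → ∀ xn : ℕ → Euc nx,
      (∀ n, xn n ∈ exhaustion D.X mt) → Tendsto (fun n => wordD stdDir w
        (fioApply D.Y χ κ ψ (Pn n) - fioApply D.Y χ κ ψ P) (xn n)) atTop (𝓝 0) := by
    intro w hw xn hxn
    refine tendsto_of_subseq_tendsto fun ns hns => ?_
    obtain ⟨x, hx, φ, hφ, ht⟩ := (isCompact_exhaustion D.X mt).tendsto_subseq
      (x := xn ∘ ns) fun n => hxn _
    have hns' : Tendsto (fun k => ns (φ k)) atTop atTop := hns.comp hφ.tendsto_atTop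
    exact ⟨φ, tendsto_wordD_fioApply_sub_of_tendsto (Pn := fun k => Pn (ns (φ k))) hR
      (fun k => hPn _) hP (fun m => ⟨(h m).1.comp hns', (h m).2.comp hns'⟩) hw
      (fun k => (hxn _).1) hx.1 ht⟩
  refine ENNReal.tendsto_nhds_zero.2 fun ε hε => ?_
  have hfin : {j : Fin nx → ℕ | len j ≤ mt}.Finite :=
    ((finite_len_le nx 0 0 mt).image Prod.fst).subset fun j hj =>
      ⟨(j, 0, 0), by simpa [len] using hj, rfl⟩
  have key : ∀ j ∈ {j : Fin nx → ℕ | len j ≤ mt}, ∀ᶠ n in atTop, ∀ x ∈ exhaustion D.X mt,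
      ‖multiD stdDir j (fioApply D.Y χ κ ψ (Pn n) - fioApply D.Y χ κ ψ P) x‖ₑ ≤ ε := by
    intro j hj
    rcases (exhaustion D.X mt).eq_empty_or_nonempty with he | ⟨x₀, hx₀⟩
    · simp [he]
    -- The selected point violates the bound ε whenever some point does, so the bound at this point
    -- alone yields it on the whole set.
    have hsel : ∀ n, ∃ x ∈ exhaustion D.X mt,
        ‖multiD stdDir j (fioApply D.Y χ κ ψ (Pn n) - fioApply D.Y χ κ ψ P) x‖ₑ ≤ ε →
        ∀ x ∈ exhaustion D.X mt,
          ‖multiD stdDir j (fioApply D.Y χ κ ψ (Pn n) - fioApply D.Y χ κ ψ P) x‖ₑ ≤ ε := by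
      intro n
      by_cases hn : ∀ x ∈ exhaustion D.X mt,
          ‖multiD stdDir j (fioApply D.Y χ κ ψ (Pn n) - fioApply D.Y χ κ ψ P) x‖ₑ ≤ ε
      · exact ⟨x₀, hx₀, fun _ => hn⟩
      · push Not at hn
        obtain ⟨x, hx, hlt⟩ := hn
        exact ⟨x, hx, fun hle => absurd hle hlt.not_ge⟩
    choose xn hxn hxn' using hsel
    have h0 := tendsto_zero_iff_enorm_tendsto_zero.1
      (hseq (multiWord j) ((length_multiWord j).trans_le hj) xn hxn)
    filter_upwards [ENNReal.tendsto_nhds_zero.1 h0 ε hε] with n hn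
    refine hxn' n ?_
    rwa [multiD_eq_wordD]
  filter_upwards [(eventually_all_finite hfin).2 key] with n hn
  exact iSup₂_le fun x hx => iSup₂_le fun j hj => hn j hj x hx

theorem exists_uniform_bound (hR : D.Regular χ ψ mt κ) (hm : κ + mt + 1 ≤ m)
    (hs : tsupport ψ ⊆ exhaustion D.Y m) :
    ∃ C : ℝ≥0∞ → ℝ≥0∞ → ℝ≥0, ∀ P ∈ fioSpace D.α D.d D.ρ D.δ D.X D.Y nξ,
      ∀ j : Fin nx → ℕ, len j ≤ mt → ∀ x ∈ exhaustion D.X mt, ∀ y ∈ D.Y, ∀ ξ ∈ punctured nξ,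
        ‖multiD dirX j (regIntegrand χ κ ψ P) (x, y, ξ)‖
          ≤ C (phaseSeminorm D.X D.Y m P.1) (ampSeminorm D.d D.ρ D.δ D.X D.Y m P.2)
            * bracket ξ ^ (-((nξ : ℝ) + 1)) := by
  have hex : ∀ (R : ℝ) (j : Fin nx → ℕ), ∃ C : ℝ, len j ≤ mt →
      ∀ P ∈ fioSpace D.α D.d D.ρ D.δ D.X D.Y nξ,
      phaseSeminorm D.X D.Y m P.1 ≤ ENNReal.ofReal R →
      ampSeminorm D.d D.ρ D.δ D.X D.Y m P.2 ≤ ENNReal.ofReal R →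
      ∀ x ∈ exhaustion D.X m, ∀ y, ∀ ξ ∈ punctured nξ,
        ‖multiD dirX j (regIntegrand χ κ ψ P) (x, y, ξ)‖ ≤ C * bracket ξ ^ (-((nξ : ℝ) + 1)) := by
    intro R j
    by_cases hj : len j ≤ mt
    · obtain ⟨C, hC⟩ := exists_bound_wordD_regIntegrand hR hm hs
        (w := multiWord j) ((length_multiWord j).trans_le hj) R
      exact ⟨C, fun _ => by simpa only [multiD_eq_wordD] using hC⟩
    · exact ⟨0, fun h => absurd h hj⟩
  choose C hC using hex
  choose B hB using fun R => exists_common_bound nx 0 0 mt fun j _ _ => C R j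
  -- Each pair lies in the ball whose radius is the larger of its own two seminorms. These are
  -- finite, so the value of `toReal` at infinity plays no role.
  refine ⟨fun p q => (B (max p q).toReal).toNNReal, fun P hP j hj x hx y _ ξ hξ => ?_⟩
  have hpq : max (phaseSeminorm D.X D.Y m P.1) (ampSeminorm D.d D.ρ D.δ D.X D.Y m P.2) ≠ ⊤ :=
    (max_lt (phaseSeminorm_lt_top hP.1.1 m) (ampSeminorm_lt_top hP.2 m)).ne
  refine (hC _ j hj P hP (le_ofReal_toReal (le_max_left _ _) hpq)
    (le_ofReal_toReal (le_max_right _ _) hpq) x (exhaustion_mono _ (by omega) hx) y ξ hξ).trans ?_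
  refine mul_le_mul_of_nonneg_right ?_ (Real.rpow_nonneg (bracket_pos ξ).le _)
  exact (hB _ j 0 0 (by simpa [len] using hj)).trans (Real.le_coe_toNNReal _)

end FioData

end FourierOp

end

theorem mainTheorem4 {nx ny nξ : ℕ}
    (X : TopologicalSpace.Opens (FourierOp.Euc nx)) (Y : TopologicalSpace.Opens (FourierOp.Euc ny))
    (α d ρ δ : ℝ) (hα : 0 < α) (hδ0 : 0 ≤ δ) (hδ1 : δ < 1) (hρ0 : 0 < ρ) (hρ1 : ρ ≤ 1)
    (χ : 𝓓((⊤ : TopologicalSpace.Opens (FourierOp.Euc nξ)), ℂ)) (hχ : FourierOp.IsCutoff χ)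
    (ψ : 𝓓(Y, ℂ)) (mt κ : ℕ)
    (hκ : d + (mt : ℝ) - (κ : ℝ) * min (1 - δ) ρ ≤ -((nξ : ℝ) + 1)) :
    (∀ m : ℕ, κ + mt + 1 ≤ m → tsupport (ψ : FourierOp.Euc ny → ℂ) ⊆ FourierOp.exhaustion Y m →
      ∃ C : ℝ≥0∞ → ℝ≥0∞ → ℝ≥0,
        ∀ P ∈ FourierOp.fioSpace α d ρ δ X Y nξ,
        ∀ j : Fin nx → ℕ, FourierOp.len j ≤ mt →
        ∀ x ∈ FourierOp.exhaustion X mt, ∀ y ∈ Y, ∀ ξ ∈ FourierOp.punctured nξ,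
          ‖FourierOp.multiD FourierOp.dirX j (FourierOp.regIntegrand χ κ ψ P) (x, y, ξ)‖
            ≤ C (FourierOp.phaseSeminorm X Y m P.1) (FourierOp.ampSeminorm d ρ δ X Y m P.2)
              * FourierOp.bracket ξ ^ (-((nξ : ℝ) + 1))) ∧
    (∀ P ∈ FourierOp.fioSpace α d ρ δ X Y nξ,
      (∀ x ∈ X, IntegrableOn (fun q : FourierOp.Euc ny × FourierOp.Euc nξ =>
          FourierOp.regIntegrand χ κ ψ P (x, q.1, q.2))
        ((Y : Set (FourierOp.Euc ny)) ×ˢ FourierOp.punctured nξ)) ∧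
      ContDiffOn ℝ mt (FourierOp.fioApply Y χ κ ψ P) X) ∧
    (∀ (P : ℕ → (FourierOp.Triple nx ny nξ → ℝ) × (FourierOp.Triple nx ny nξ → ℂ))
       (P' : (FourierOp.Triple nx ny nξ → ℝ) × (FourierOp.Triple nx ny nξ → ℂ)),
      (∀ n, P n ∈ FourierOp.fioSpace α d ρ δ X Y nξ) → P' ∈ FourierOp.fioSpace α d ρ δ X Y nξ →
      FourierOp.Converges d ρ δ X Y P P' →
      Tendsto (fun n => FourierOp.funSeminorm X mt
        (FourierOp.fioApply Y χ κ ψ (P n) - FourierOp.fioApply Y χ κ ψ P')) atTop (𝓝 0)) := by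

  let D : FourierOp.FioData nx ny nξ :=
    ⟨X, Y, α, d, ρ, δ, hα, hδ0, hδ1, hρ0, hρ1⟩
  have hR : D.Regular χ ψ mt κ :=
    ⟨χ.contDiff, χ.hasCompactSupport, hχ.1, ψ.contDiff, ψ.hasCompactSupport, ψ.tsupport_subset, hκ⟩
  exact ⟨fun m hm hs => FourierOp.FioData.exists_uniform_bound (D := D) hR hm hs,
    fun P hP => ⟨fun x hx =>
      (FourierOp.FioData.locDominated_regIntegrand (D := D) hR hP).integrableOn hx,
      FourierOp.FioData.contDiffOn_fioApply (D := D) hR hP⟩,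
    fun P P' hP hP' h => FourierOp.FioData.tendsto_funSeminorm (D := D) hR hP hP' h⟩
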